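/- **Model.** Peers are labelled by natural numbers and the source is peer $1$. There are $M=2$ layers; each is at any time a 1-regular digraph (a permutation) on the current finite set $V$ of peers, and $p_m(v)$, $c_m(v)$ denote the parent and the child of $v$ in layer $m$. Initially $V=\{1\}$ and both layers consist of a loop. When a new peer $v$ joins, $V$ becomes $V\cup\{v\}$ and $w_1,w_2$ are chosen independently and uniformly from the new $V$; for each $m$, if $w_m=v$ then $v$ creates a loop in layer $m$, and otherwise the edge $(w_m,c_m(w_m))$ is replaced by $(w_m,v)$ and $(v,c_m(w_m))$. When a peer $v\neq 1$ leaves, $(p_m(v),v)$ and $(v,c_m(v))$ are replaced by $(p_m(v),c_m(v))$ for each $m$. Consider the network after any fixed finite sequence of joins and leaves, and let $N=|V|$. Fix $0<c<1$ and let $d^*=\lceil \log_2 (N/\log^c N)\rceil$. Each peer $v$ computes a depth $d(v)$ and a main flow $\chi(v)$ by the random flow-assignment algorithm. The source has $d=0$ and $\chi=0$. If the source is the $m^*$-th parent of $v\ne 1$, then $d(v)=1$ and $\chi(v)=m^*$. Otherwise, if $v$ has a parent of depth less than $d^*$, then $d(v)=d(p_{m^*}(v))+1$ and $\chi(v)=\chi(p_{m^*}(v))$,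 where $p_{m^*}(v)$ is the parent of smallest depth. Otherwise $d(v)=\infty$ and $\chi(v)=0$. Ties in the choice of $m^*$ are broken by independent fair coins, one for each peer, independent of the layers. The initial values are $d(v)=\infty$, $\chi(v)=0$ for $v\neq 1$, and the algorithm is rerun until no value changes. Let $N_d=|\{v\in V: d(v)=d\}|$, let $N_{>d-1}=N-\sum_{h<d}N_h$, and let $X_d=|\{v\in V: d(v)=d,\ \chi(v)=1\}|$ be the number of flow-1 peers in depth $d$. Put $d_1=\lceil \tfrac13\log_2 N\rceil$, $d_2=\lceil \tfrac56\log_2 N\rceil$, and $$\phi_d=\begin{cases}1 & 0\le d<d_1,\\ 1-N^{-1/9} & d_1\le d<d_2,\\ \left(1-\dfrac{N_d}{N_{>d-1}}\right)^3 & d\ge d_2.\end{cases}$$ **Proposition 4.** For every $\epsilon>0$ there is an $N_0$, depending only on $c$ and $\epsilon$, such that, whenever $N\ge N_0$, the event that $N_d\ge 2\phi_{d-1}N_{d-1}$ for all $1\le d\le d^*$ has positive probability and, conditioned on it, $$\Pr\left\{\left|\frac{X_d}{N_d}-\frac12\right|<\epsilon\ \text{ for all } 1\le d\le d^*\right\}\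 \ge\ 1-\frac{2\log_2 N}{\exp\left(\dfrac{(1-\epsilon)N^{1/3}}{4\log_2^4 N}\right)}.$$ The same bound holds conditioned on any realization $(N_0,\dots,N_{d^*})=(n_0,\dots,n_{d^*})$ of positive probability that satisfies these inequalities. -/

import Mathlib

namespace P2P

open Equiv

/-- Peers carry labels in `ℕ`; the source is peer `1`. -/
def source : ℕ := 1

/-- The two layers of the network. A 1-regular digraph on a finite set `V` of peers is a
permutation of `V`; it is represented by the permutation of all labels that fixes every label
outside `V`. The `m`-th child of `v` is `c m v`, the `m`-th parent of `v` is `(c m).symm v`. -/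
abbrev Layers : Type := Fin 2 → Perm ℕ

/-- The new peer `v` breaks into the outgoing edge `(w, w')` of `w`, which is replaced by
`(w, v)` and `(v, w')`; if `w = v`, then `v` creates a loop. (Before the call, `v` is fixed.) -/
def joinLayer (c : Perm ℕ) (v w : ℕ) : Perm ℕ := c * swap w v

/-- The peer `v` leaves: its edges `(p, v)` and `(v, c v)` are replaced by `(p, c v)`. -/
def leaveLayer (c : Perm ℕ) (v : ℕ) : Perm ℕ := swap v (c v) * c

theorem joinLayer_apply_new {c : Perm ℕ} {v w : ℕ} : joinLayer c v w v = c w := by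
  simp [joinLayer]

theorem joinLayer_apply_old {c : Perm ℕ} {v w : ℕ} (h : c v = v) : joinLayer c v w w = v := by
  simp [joinLayer, h]

theorem leaveLayer_apply_self {c : Perm ℕ} {v : ℕ} : leaveLayer c v v = v := by
  simp [leaveLayer]

theorem leaveLayer_apply_parent {c : Perm ℕ} {v : ℕ} :
    leaveLayer c v (c.symm v) = c v := by
  simp [leaveLayer]

/-- The peer-pairing algorithm: `PairingLaw V μ` says that `μ` is the distribution of the two
layers after some finite sequence of joins and leaves that ends with `V` as the set of peers.
The network starts with the source and its loops. A new peer `v` is added to `V` and chooses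
`w 0, w 1` independently and uniformly from the enlarged `V`. Every peer but the source may
leave. -/
inductive PairingLaw : Finset ℕ → PMF Layers → Prop
  | init : PairingLaw {source} (PMF.pure 1)
  | join {V : Finset ℕ} {μ : PMF Layers} (v : ℕ) (hv : v ∉ V) (h : PairingLaw V μ) :
      PairingLaw (insert v V)
        (μ.bind fun c =>
          (PMF.uniformOfFinset (Fintype.piFinset fun _ : Fin 2 => insert v V)
            (Fintype.piFinset_nonempty.2 fun _ => Finset.insert_nonempty v V)).map
            fun w m => joinLayer (c m) v (w m))
  | leave {V : Finset ℕ} {μ : PMF Layers} (v : ℕ) (hv : v ∈ V) (hs : v ≠ source)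
      (h : PairingLaw V μ) :
      PairingLaw (V.erase v) (μ.map fun c m => leaveLayer (c m) v)

/-- All the randomness: the layers, and for every peer a coin that it uses to break a tie.
`coins` is the set of peers whose coin shows the first layer. -/
structure Outcome where
  layers : Layers
  coins : Finset ℕ

instance : MeasurableSpace Outcome := ⊤

/-- The coins are fair and independent of each other and of the layers, i.e., the set of peers in
`V` whose coin shows the first layer is a uniformly distributed subset of `V`. -/
noncomputable def outcomeLaw (V : Finset ℕ) (μ : PMF Layers) : PMF Outcome :=
  μ.bind fun c =>
    (PMF.uniformOfFinset V.powerset ⟨∅, Finset.empty_mem_powerset V⟩).map fun T => ⟨c, T⟩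

/-- The values `d(v)` and `χ(v)` held by a peer (`χ(v) = 0` : no main flow). -/
@[ext]
structure PeerState where
  depth : ℕ∞
  flow : ℕ

/-- The initial values; the source has depth `0`. -/
def initState (v : ℕ) : PeerState := if v = source then ⟨0, 0⟩ else ⟨⊤, 0⟩

/-- The `m`-th parent of `v`. -/
def parent (ω : Outcome) (m : Fin 2) (v : ℕ) : ℕ := (ω.layers m).symm v

/-- The index `m*` of the parent of smallest depth, where ties are broken by the coin of `v`.
(Only the source has depth `0`, so this selects the source if the source is a parent.) -/
def bestParent (ω : Outcome) (s : ℕ → PeerState) (v : ℕ) : Fin 2 :=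
  if (s (parent ω 0 v)).depth < (s (parent ω 1 v)).depth then 0
  else if (s (parent ω 1 v)).depth < (s (parent ω 0 v)).depth then 1
  else if v ∈ ω.coins then 0 else 1

open Classical in
/-- Every peer runs the random flow-assignment algorithm once, with depth threshold `D`:
the new values of `d(v)` and `χ(v)` from the current values of its parents. Layer indices
`0, 1` correspond to the flows `1, 2`. -/
noncomputable def rfaStep (ω : Outcome) (D : ℕ) (s : ℕ → PeerState) (v : ℕ) : PeerState :=
  if v = source then ⟨0, 0⟩
  else if ∃ m, parent ω m v = source then ⟨1, (bestParent ω s v : ℕ) + 1⟩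
  else if ∃ m, (s (parent ω m v)).depth < D then
    ⟨(s (parent ω (bestParent ω s v) v)).depth + 1,
      (s (parent ω (bestParent ω s v) v)).flow⟩
  else ⟨⊤, 0⟩

/-- The outcome of the random flow-assignment algorithm. Rerunning the algorithm does not change
any value after `D + 1` rounds, see `rfa_stable`. -/
noncomputable def rfa (ω : Outcome) (D : ℕ) : ℕ → PeerState := (rfaStep ω D)^[D + 1] initState

theorem bestParent_min (ω : Outcome) (s : ℕ → PeerState) (v : ℕ) (m : Fin 2) :
    (s (parent ω (bestParent ω s v) v)).depth ≤ (s (parent ω m v)).depth := by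
  unfold bestParent
  fin_cases m <;> split_ifs <;> simp_all [le_of_lt]

/-- `s` and `s'` agree on the peers of depth at most `t`, and no other peer has reached a depth
below `t + 1`. -/
def AgreeUpTo (t : ℕ) (s s' : ℕ → PeerState) : Prop :=
  s source = ⟨0, 0⟩ ∧ s' source = ⟨0, 0⟩ ∧ ∀ v, (s v = s' v ∧ (s v).depth ≤ (t : ℕ∞)) ∨
    (s v = ⟨⊤, 0⟩ ∧ ((t + 1 : ℕ) : ℕ∞) ≤ (s' v).depth)

theorem AgreeUpTo.best {t : ℕ} {s s' : ℕ → PeerState} (h : AgreeUpTo t s s') (ω : Outcome)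
    {v : ℕ} {m : Fin 2} (hm : (s (parent ω m v)).depth ≤ (t : ℕ∞)) :
    bestParent ω s v = bestParent ω s' v ∧
      s (parent ω (bestParent ω s v) v) = s' (parent ω (bestParent ω s v) v) ∧
      (s (parent ω (bestParent ω s v) v)).depth ≤ (t : ℕ∞) := by
  have key : (s (parent ω (bestParent ω s v) v)).depth ≤ (t : ℕ∞) :=
    (bestParent_min ω s v m).trans hm
  have lt1 : ((t : ℕ) : ℕ∞) < ((t + 1 : ℕ) : ℕ∞) := by exact_mod_cast Nat.lt_succ_self t
  have top : ¬ ((⊤ : ℕ∞) ≤ (t : ℕ∞)) := by simp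
  refine ⟨?_, ?_, key⟩
  · rcases h.2.2 (parent ω 0 v) with ⟨e0, l0⟩ | ⟨e0, l0⟩ <;>
      rcases h.2.2 (parent ω 1 v) with ⟨e1, l1⟩ | ⟨e1, l1⟩
    · simp [bestParent, e0, e1]
    · have a : (s (parent ω 0 v)).depth < (s (parent ω 1 v)).depth := by
        rw [e1]; exact lt_of_le_of_lt l0 (by simp)
      have b : (s' (parent ω 0 v)).depth < (s' (parent ω 1 v)).depth := by
        rw [← e0]; exact (l0.trans_lt lt1).trans_le l1
      simp [bestParent, a, b]
    · have a : (s (parent ω 1 v)).depth < (s (parent ω 0 v)).depth := by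
        rw [e0]; exact lt_of_le_of_lt l1 (by simp)
      have b : (s' (parent ω 1 v)).depth < (s' (parent ω 0 v)).depth := by
        rw [← e1]; exact (l1.trans_lt lt1).trans_le l0
      simp [bestParent, a, b, a.not_gt, b.not_gt]
    · exfalso
      fin_cases m
      · simp [e0] at hm
      · simp [e1] at hm
  · rcases h.2.2 (parent ω (bestParent ω s v) v) with ⟨e, -⟩ | ⟨e, -⟩
    · exact e
    · rw [e] at key; exact absurd key top

theorem AgreeUpTo.step {t : ℕ} {s s' : ℕ → PeerState} (h : AgreeUpTo t s s') (ω : Outcome)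
    (D : ℕ) : AgreeUpTo (t + 1) (rfaStep ω D s) (rfaStep ω D s') := by
  refine ⟨by simp [rfaStep], by simp [rfaStep], fun v => ?_⟩
  by_cases hv : v = source
  · left; simp [rfaStep, hv]
  by_cases hp : ∃ m, parent ω m v = source
  · obtain ⟨m, hm⟩ := hp
    have hb := (h.best ω (v := v) (m := m) (by rw [hm, h.1]; simp)).1
    left
    have hp : ∃ m, parent ω m v = source := ⟨m, hm⟩
    simp only [rfaStep, if_neg hv, if_pos hp, hb, true_and]
    simp
  by_cases hd : ∃ m, (s (parent ω m v)).depth < D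
  · obtain ⟨m, hm⟩ := hd
    have hmt : (s (parent ω m v)).depth ≤ (t : ℕ∞) := by
      rcases h.2.2 (parent ω m v) with ⟨-, l⟩ | ⟨e, -⟩
      · exact l
      · simp [e] at hm
    obtain ⟨b1, b2, b3⟩ := h.best ω hmt
    have hd : ∃ m, (s (parent ω m v)).depth < D := ⟨m, hm⟩
    have hd' : ∃ m, (s' (parent ω m v)).depth < D :=
      ⟨bestParent ω s v, by rw [← b2]; exact (bestParent_min ω s v m).trans_lt hm⟩
    left
    simp only [rfaStep, if_neg hv, if_neg hp, if_pos hd, if_pos hd', ← b1, ← b2, true_and]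
    push_cast
    gcongr
  · right
    refine ⟨by simp only [rfaStep, if_neg hv, if_neg hp, if_neg hd], ?_⟩
    by_cases hd' : ∃ m, (s' (parent ω m v)).depth < D
    · simp only [rfaStep, if_neg hv, if_neg hp, if_pos hd']
      obtain ⟨m, hm⟩ := hd'
      have hb := (bestParent_min ω s' v m).trans_lt hm
      rcases h.2.2 (parent ω (bestParent ω s' v) v) with ⟨e, -⟩ | ⟨-, l⟩
      · exact absurd ⟨_, by rw [e]; exact hb⟩ hd
      · rw [Nat.cast_add (t + 1) 1]
        gcongr
        simp
    · simp only [rfaStep, if_neg hv, if_neg hp, if_neg hd']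
      exact le_top

theorem agreeUpTo_iterate (ω : Outcome) (D t : ℕ) :
    AgreeUpTo t ((rfaStep ω D)^[t] initState) ((rfaStep ω D)^[t + 1] initState) := by
  induction t with
  | zero =>
    refine ⟨by simp [initState], by simp [rfaStep], fun v => ?_⟩
    by_cases hv : v = source
    · left; simp [rfaStep, initState, hv]
    · right
      refine ⟨by simp [initState, hv], ?_⟩
      simp only [zero_add, Function.iterate_one, rfaStep, if_neg hv]
      split_ifs <;> simp
  | succ t ih =>
    rw [Function.iterate_succ_apply', Function.iterate_succ_apply' _ (t + 1)]
    exact ih.step ω D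

theorem rfa_stable (ω : Outcome) (D : ℕ) : rfaStep ω D (rfa ω D) = rfa ω D := by
  have h := agreeUpTo_iterate ω D (D + 1)
  rw [Function.iterate_succ_apply' _ (D + 1)] at h
  change AgreeUpTo (D + 1) (rfa ω D) (rfaStep ω D (rfa ω D)) at h
  funext v
  rcases h.2.2 v with ⟨e, -⟩ | ⟨e, l⟩
  · exact e.symm
  rw [e]
  revert l
  unfold rfaStep
  have two : ¬ (((D + 1 + 1 : ℕ) : ℕ∞) ≤ 1) := by
    intro l
    have : D + 1 + 1 ≤ 1 := by exact_mod_cast l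
    omega
  split_ifs with h1 h2 h3
  · intro l; exact absurd (l.trans (by simp)) two
  · intro l; exact absurd l two
  · intro l
    obtain ⟨m, hm⟩ := h3
    have hb := (bestParent_min ω (rfa ω D) v m).trans_lt hm
    have l2 := l.trans (add_le_add_left hb.le 1)
    have : D + 1 + 1 ≤ D + 1 := by exact_mod_cast l2
    omega
  · intro _; rfl

/-- `N_d`, the number of peers in depth `d`. -/
noncomputable def levelCount (V : Finset ℕ) (D : ℕ) (ω : Outcome) (d : ℕ) : ℕ :=
  {v ∈ V | (rfa ω D v).depth = d}.card

open Classical in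
/-- `X_d`, the number of flow-1 peers in depth `d`. -/
noncomputable def flowOneCount (V : Finset ℕ) (D : ℕ) (ω : Outcome) (d : ℕ) : ℕ :=
  {v ∈ V | (rfa ω D v).depth = d ∧ (rfa ω D v).flow = 1}.card

/-- `d* = ⌈log₂ (N / log^c N)⌉`. -/
noncomputable def dStar (c : ℝ) (N : ℕ) : ℕ := ⌈Real.logb 2 (N / Real.log N ^ c)⌉₊

/-- `d₁ = ⌈(log₂ N) / 3⌉`. -/
noncomputable def dOne (N : ℕ) : ℕ := ⌈Real.logb 2 N / 3⌉₊

/-- `d₂ = ⌈5 (log₂ N) / 6⌉`. -/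
noncomputable def dTwo (N : ℕ) : ℕ := ⌈5 * Real.logb 2 N / 6⌉₊

/-- `φ_d`, where `n h` is the number of peers in depth `h`, so that
`N - ∑ h < d, n h` is the number of peers beyond depth `d - 1`. -/
noncomputable def phi (N : ℕ) (n : ℕ → ℕ) (d : ℕ) : ℝ :=
  if d < dOne N then 1
  else if d < dTwo N then 1 - (N : ℝ) ^ (-(1 / 9) : ℝ)
  else (1 - (n d : ℝ) / ((N : ℝ) - ∑ h ∈ Finset.range d, (n h : ℝ))) ^ 3

/-- `n_d ≥ 2 φ_{d-1} n_{d-1}` for all `1 ≤ d ≤ d*`. -/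
def NearBinary (c : ℝ) (N : ℕ) (n : ℕ → ℕ) : Prop :=
  ∀ d, 1 ≤ d → d ≤ dStar c N → 2 * phi N n (d - 1) * (n (d - 1) : ℝ) ≤ (n d : ℝ)

/-- `|X_d / N_d - 1/2| < ε` for all `1 ≤ d ≤ d*`. -/
def Balanced (c ε : ℝ) (V : Finset ℕ) (ω : Outcome) : Prop :=
  ∀ d, 1 ≤ d → d ≤ dStar c V.card →
    |(flowOneCount V (dStar c V.card) ω d : ℝ) / (levelCount V (dStar c V.card) ω d : ℝ) - 1 / 2|
      < ε

/-- `1 - 2 log₂ N / exp ((1 - ε) N^{1/3} / (4 log₂⁴ N))`. -/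
noncomputable def lowerBound (ε : ℝ) (N : ℕ) : ℝ :=
  1 - 2 * Real.logb 2 N /
    Real.exp ((1 - ε) * (N : ℝ) ^ (1 / 3 : ℝ) / (4 * Real.logb 2 N ^ 4))

end P2P

/-!
Joining and leaving preserve the uniform law, so all pairs of permutations of `V` are equally
likely. Composing the layers with random permutations of the peers of depth `d` rewires only the
parents of depth `d`: it preserves the uniform law, the levels and flows up to depth `d`, and all
level counts, and it turns the number of flow-1 peers of depth `d + 1` into the number of points
that random permutations send into the set of flow-1 peers of depth `d`. The indicators of these
hits are negatively correlated, which gives a Chernoff bound: conditioned on the level counts,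
`X_{d+1} / N_{d+1}` deviates from `X_d / N_d` by `ε / log₂ N` or more with probability at most
`2 exp (-N_{d+1} (ε / log₂ N)² / 4)`. The hypothesis forces a full binary tree down to depth `d₁`,
where the ratio is exactly `1/2` at every depth `d ≥ 1`, and `N_d ≥ N^{1/3}` from `d₁` on. A union
bound over fewer than `log₂ N` levels concludes. The conditioning event has positive probability
because some pair of layers has a full binary tree of depth `d*`.
-/

namespace P2P

open Equiv Finset

section PermsOfFinset

variable {α : Type*} [DecidableEq α] {L S X : Finset α} {σ τ : Perm α} {a b x : α}

theorem mem_permsOfFinset : σ ∈ permsOfFinset L ↔ ∀ x ∉ L, σ x = x :=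
  mem_perms_of_finset_iff.trans <| forall_congr' fun _ => not_imp_comm

theorem one_mem_permsOfFinset : 1 ∈ permsOfFinset L :=
  mem_permsOfFinset.2 fun _ _ => rfl

theorem mul_mem_permsOfFinset (hσ : σ ∈ permsOfFinset L) (hτ : τ ∈ permsOfFinset L) :
    σ * τ ∈ permsOfFinset L := by
  rw [mem_permsOfFinset] at *
  intro x hx
  rw [Perm.mul_apply, hτ x hx, hσ x hx]

theorem inv_mem_permsOfFinset (hσ : σ ∈ permsOfFinset L) : σ⁻¹ ∈ permsOfFinset L :=
  mem_permsOfFinset.2 fun x hx => Perm.inv_eq_iff_eq.2 (mem_permsOfFinset.1 hσ x hx).symm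

theorem permsOfFinset_mono (h : S ⊆ L) : permsOfFinset S ⊆ permsOfFinset L := fun _ hσ =>
  mem_permsOfFinset.2 fun x hx => mem_permsOfFinset.1 hσ x fun hxS => hx (h hxS)

theorem swap_mem_permsOfFinset (ha : a ∈ L) (hb : b ∈ L) : swap a b ∈ permsOfFinset L :=
  mem_permsOfFinset.2 fun _ hx =>
    swap_apply_of_ne_of_ne (ne_of_mem_of_not_mem ha hx).symm (ne_of_mem_of_not_mem hb hx).symm

theorem apply_mem_iff_of_mem_permsOfFinset (hσ : σ ∈ permsOfFinset L) : σ x ∈ L ↔ x ∈ L := by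
  rw [mem_permsOfFinset] at hσ
  refine ⟨fun h => ?_, fun h => ?_⟩ <;> by_contra hx
  · exact hx (hσ x hx ▸ h)
  · exact hx (by rwa [σ.injective (hσ _ hx)])

/-- Conditioning on `σ a ∈ X` for `a ∈ S` does not raise the chance of `σ b ∈ X`. -/
theorem card_perms_mapsTo_insert_mul_le (hb : b ∈ L) (hbS : b ∉ S) :
    #{σ ∈ permsOfFinset L | ∀ a ∈ insert b S, σ a ∈ X} * #L ≤
      #{σ ∈ permsOfFinset L | ∀ a ∈ S, σ a ∈ X} * #X := by
  set P := {σ ∈ permsOfFinset L | ∀ a ∈ S, σ a ∈ X} with hP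
  have hinsert : {σ ∈ permsOfFinset L | ∀ a ∈ insert b S, σ a ∈ X} = {σ ∈ P | σ b ∈ X} := by
    rw [hP, filter_filter]
    simp only [forall_mem_insert, and_comm]
  have hmax : ∀ y ∈ L, #{σ ∈ P | σ b ∈ X} ≤ #{σ ∈ P | σ y ∈ X} := by
    intro y hy
    by_cases hyS : y ∈ S
    · exact card_le_card fun σ hσ => mem_filter.2
        ⟨(mem_filter.1 hσ).1, (mem_filter.1 (mem_filter.1 hσ).1).2 y hyS⟩
    · refine card_le_card_of_injOn (· * swap b y) (fun σ hσ => ?_) (mul_left_injective _).injOn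
      simp only [hP, coe_filter, mem_filter, Set.mem_ofPred_eq] at hσ ⊢
      refine ⟨⟨mul_mem_permsOfFinset hσ.1.1 (swap_mem_permsOfFinset hb hy), fun a ha => ?_⟩,
        by simpa using hσ.2⟩
      rw [Perm.mul_apply, swap_apply_of_ne_of_ne (ne_of_mem_of_not_mem ha hbS)
        (ne_of_mem_of_not_mem ha hyS)]
      exact hσ.1.2 a ha
  calc #{σ ∈ permsOfFinset L | ∀ a ∈ insert b S, σ a ∈ X} * #L
      = ∑ _y ∈ L, #{σ ∈ P | σ b ∈ X} := by rw [hinsert, sum_const, smul_eq_mul, mul_comm]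
    _ ≤ ∑ y ∈ L, #{σ ∈ P | σ y ∈ X} := sum_le_sum hmax
    _ = ∑ σ ∈ P, #{y ∈ L | σ y ∈ X} :=
        sum_card_bipartiteAbove_eq_sum_card_bipartiteBelow fun y (σ : Perm α) => σ y ∈ X
    _ ≤ ∑ _σ ∈ P, #X := sum_le_sum fun σ _ => card_le_card_of_injOn σ
        (fun y hy => (mem_filter.1 hy).2) σ.injective.injOn
    _ = #P * #X := by rw [sum_const, smul_eq_mul]

theorem card_perms_mapsTo_mul_pow_le (hS : S ⊆ L) :
    #{σ ∈ permsOfFinset L | ∀ a ∈ S, σ a ∈ X} * #L ^ #S ≤ #(permsOfFinset L) * #X ^ #S := by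
  induction S using Finset.induction_on with
  | empty => simp
  | insert b S hbS ih =>
    rw [insert_subset_iff] at hS
    rw [card_insert_of_notMem hbS]
    calc #{σ ∈ permsOfFinset L | ∀ a ∈ insert b S, σ a ∈ X} * #L ^ (#S + 1)
        = #{σ ∈ permsOfFinset L | ∀ a ∈ insert b S, σ a ∈ X} * #L * #L ^ #S := by ring
      _ ≤ #{σ ∈ permsOfFinset L | ∀ a ∈ S, σ a ∈ X} * #X * #L ^ #S :=
          Nat.mul_le_mul_right _ (card_perms_mapsTo_insert_mul_le hS.1 hbS)
      _ = #{σ ∈ permsOfFinset L | ∀ a ∈ S, σ a ∈ X} * #L ^ #S * #X := by ring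
      _ ≤ #(permsOfFinset L) * #X ^ #S * #X := Nat.mul_le_mul_right _ (ih hS.2)
      _ = #(permsOfFinset L) * #X ^ (#S + 1) := by ring

theorem card_perms_mapsTo_le (hS : S ⊆ L) :
    (#{σ ∈ permsOfFinset L | ∀ a ∈ S, σ a ∈ X} : ℝ) ≤
      #(permsOfFinset L) * (#X / #L : ℝ) ^ #S := by
  rcases S.eq_empty_or_nonempty with rfl | hne
  · simp
  have hL : 0 < #L := (hne.mono hS).card_pos
  rw [div_pow, mul_div_assoc', le_div_iff₀ (by positivity)]
  exact_mod_cast card_perms_mapsTo_mul_pow_le hS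

theorem exp_mul_card_filter_mem (B X : Finset α) (s : ℝ) (σ : Perm α) :
    Real.exp (s * #{u ∈ B | σ u ∈ X}) =
      ∑ S ∈ B.powerset, if ∀ a ∈ S, σ a ∈ X then (Real.exp s - 1) ^ #S else 0 := by
  calc Real.exp (s * #{u ∈ B | σ u ∈ X})
      = ∏ u ∈ B, (1 + if σ u ∈ X then Real.exp s - 1 else 0) := by
        rw [mul_comm, Real.exp_nat_mul, ← prod_const, prod_filter]
        exact prod_congr rfl fun u _ => by split_ifs <;> ring
    _ = ∑ S ∈ B.powerset, ∏ u ∈ S, if σ u ∈ X then Real.exp s - 1 else 0 := prod_one_add B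
    _ = _ := by simp only [prod_ite_zero, prod_const]

theorem sum_perms_exp_le {B : Finset α} (hB : B ⊆ L) (hX : X ⊆ L) {s : ℝ} (hs0 : 0 ≤ s)
    (hs1 : s ≤ 1) :
    ∑ σ ∈ permsOfFinset L, Real.exp (s * #{u ∈ B | σ u ∈ X}) ≤
      #(permsOfFinset L) * Real.exp (#B * (#X / #L * s + s ^ 2)) := by
  set p : ℝ := #X / #L with hp
  set x : ℝ := Real.exp s - 1 with hx
  have hp0 : 0 ≤ p := by positivity
  have hp1 : p ≤ 1 := div_le_one_of_le₀ (by exact_mod_cast card_le_card hX) (by positivity)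
  have hx0 : 0 ≤ x := by linarith [Real.add_one_le_exp s]
  have hxs : x ≤ s + s ^ 2 := by
    linarith [(abs_le.1 (Real.abs_exp_sub_one_sub_id_le (abs_le.2 ⟨by linarith, hs1⟩))).2]
  calc ∑ σ ∈ permsOfFinset L, Real.exp (s * #{u ∈ B | σ u ∈ X})
      = ∑ S ∈ B.powerset, #{σ ∈ permsOfFinset L | ∀ a ∈ S, σ a ∈ X} * x ^ #S := by
        simp only [exp_mul_card_filter_mem, ← hx]
        rw [sum_comm]
        exact sum_congr rfl fun S _ => by rw [← sum_filter, sum_const, nsmul_eq_mul]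
    _ ≤ ∑ S ∈ B.powerset, #(permsOfFinset L) * p ^ #S * x ^ #S := by
        gcongr with S hS
        exact card_perms_mapsTo_le ((mem_powerset.1 hS).trans hB)
    _ = #(permsOfFinset L) * (1 + p * x) ^ #B := by
        rw [← prod_const, prod_one_add, mul_sum]
        simp only [prod_const, mul_pow, mul_assoc]
    _ ≤ #(permsOfFinset L) * Real.exp (#B * (p * s + s ^ 2)) := by
        rw [Real.exp_nat_mul]
        gcongr
        calc 1 + p * x ≤ p * s + s ^ 2 + 1 := by
              nlinarith [mul_le_mul_of_nonneg_left hxs hp0, sq_nonneg s]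
          _ ≤ _ := Real.add_one_le_exp _

end PermsOfFinset

section HitCount

variable {ι α : Type*} [Fintype ι] [DecidableEq α] {L X : Finset α} {B : ι → Finset α}

/-- The number of pairs `(i, u)` with `u ∈ B i` that a family of permutations sends into `X`. For
uniform random permutations this is a sum of negatively correlated indicators. -/
def hitCount (B : ι → Finset α) (X : Finset α) (σ : ι → Perm α) : ℕ :=
  ∑ i, #{u ∈ B i | σ i u ∈ X}

theorem hitCount_add_hitCount_sdiff (hB : ∀ i, B i ⊆ L) {σ : ι → Perm α}
    (hσ : ∀ i, σ i ∈ permsOfFinset L) :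
    hitCount B X σ + hitCount B (L \ X) σ = ∑ i, #(B i) := by
  rw [hitCount, hitCount, ← sum_add_distrib]
  refine sum_congr rfl fun i _ => ?_
  rw [← card_filter_add_card_filter_not (s := B i) (fun u => σ i u ∈ X)]
  congr 2
  refine filter_congr fun u hu => ?_
  rw [mem_sdiff, and_iff_right ((apply_mem_iff_of_mem_permsOfFinset (hσ i)).2 (hB i hu))]

variable [DecidableEq ι]

theorem sum_exp_hitCount_le (hB : ∀ i, B i ⊆ L) (hX : X ⊆ L) {s : ℝ} (hs0 : 0 ≤ s)
    (hs1 : s ≤ 1) :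
    ∑ σ ∈ Fintype.piFinset fun _ : ι => permsOfFinset L, Real.exp (s * hitCount B X σ) ≤
      #(Fintype.piFinset fun _ : ι => permsOfFinset L) *
        Real.exp ((∑ i, #(B i) : ℕ) * (#X / #L * s + s ^ 2)) := by
  calc ∑ σ ∈ Fintype.piFinset fun _ : ι => permsOfFinset L, Real.exp (s * hitCount B X σ)
      = ∏ i, ∑ τ ∈ permsOfFinset L, Real.exp (s * #{u ∈ B i | τ u ∈ X}) := by
        rw [prod_univ_sum]
        refine sum_congr rfl fun σ _ => ?_
        rw [← Real.exp_sum, ← mul_sum, hitCount, Nat.cast_sum]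
    _ ≤ ∏ i, #(permsOfFinset L) * Real.exp (#(B i) * (#X / #L * s + s ^ 2)) :=
        prod_le_prod (fun i _ => by positivity) fun i _ => sum_perms_exp_le (hB i) hX hs0 hs1
    _ = _ := by
        rw [prod_mul_distrib, ← Real.exp_sum, ← sum_mul, Fintype.card_piFinset]
        push_cast
        rfl

open Classical in
theorem card_hitCount_ge_le (hB : ∀ i, B i ⊆ L) (hX : X ⊆ L) {δ : ℝ} (hδ0 : 0 ≤ δ)
    (hδ2 : δ ≤ 2) :
    (#{σ ∈ Fintype.piFinset fun _ : ι => permsOfFinset L |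
        (#X / #L + δ : ℝ) * (∑ i, #(B i) : ℕ) ≤ hitCount B X σ} : ℝ) ≤
      Real.exp (-((∑ i, #(B i) : ℕ) * δ ^ 2 / 4)) *
        #(Fintype.piFinset fun _ : ι => permsOfFinset L) := by
  set P := Fintype.piFinset fun _ : ι => permsOfFinset L
  set n : ℕ := ∑ i, #(B i)
  set a : ℝ := δ / 2 * ((#X / #L + δ) * n) with ha
  calc (#{σ ∈ P | (#X / #L + δ : ℝ) * n ≤ hitCount B X σ} : ℝ)
      ≤ ∑ σ ∈ P, Real.exp (δ / 2 * hitCount B X σ - a) := by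
        rw [card_filter]
        push_cast
        refine sum_le_sum fun σ _ => ?_
        split_ifs with h
        · exact Real.one_le_exp (sub_nonneg.2 (mul_le_mul_of_nonneg_left h (by positivity)))
        · positivity
    _ = (∑ σ ∈ P, Real.exp (δ / 2 * hitCount B X σ)) * Real.exp (-a) := by
        rw [sum_mul]
        simp only [← Real.exp_add, sub_eq_add_neg]
    _ ≤ #P * Real.exp (n * (#X / #L * (δ / 2) + (δ / 2) ^ 2)) * Real.exp (-a) := by
        gcongr
        exact sum_exp_hitCount_le hB hX (by linarith) (by linarith)
    _ = Real.exp (-(n * δ ^ 2 / 4)) * #P := by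
        rw [mul_assoc, ← Real.exp_add, mul_comm]
        congr 2
        rw [ha]
        ring

open Classical in
/-- The lower tail for `X` is the upper tail for `L \ X`. -/
theorem card_hitCount_deviation_le (hB : ∀ i, B i ⊆ L) (hX : X ⊆ L) {δ : ℝ} (hδ0 : 0 ≤ δ)
    (hδ2 : δ ≤ 2) :
    (#{σ ∈ Fintype.piFinset fun _ : ι => permsOfFinset L |
        δ * (∑ i, #(B i) : ℕ) ≤ |hitCount B X σ - #X / #L * ((∑ i, #(B i) : ℕ) : ℝ)|} : ℝ) ≤
      2 * Real.exp (-((∑ i, #(B i) : ℕ) * δ ^ 2 / 4)) *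
        #(Fintype.piFinset fun _ : ι => permsOfFinset L) := by
  set P := Fintype.piFinset fun _ : ι => permsOfFinset L
  set n : ℕ := ∑ i, #(B i) with hn
  have hcompl : (#(L \ X) / #L * n : ℝ) = n - #X / #L * n := by
    rcases L.eq_empty_or_nonempty with rfl | hL
    · simp [hn, fun i => subset_empty.1 (hB i)]
    · have := hL.card_pos
      rw [card_sdiff_of_subset hX, Nat.cast_sub (card_le_card hX)]
      field_simp
  have hsub : {σ ∈ P | δ * n ≤ |(hitCount B X σ : ℝ) - #X / #L * n|} ⊆
      {σ ∈ P | (#X / #L + δ : ℝ) * n ≤ hitCount B X σ} ∪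
        {σ ∈ P | (#(L \ X) / #L + δ : ℝ) * n ≤ hitCount B (L \ X) σ} := by
    intro σ hσ
    obtain ⟨hσP, hdev⟩ := mem_filter.1 hσ
    have hsum : (hitCount B X σ : ℝ) + hitCount B (L \ X) σ = n := by
      exact_mod_cast hitCount_add_hitCount_sdiff hB (Fintype.mem_piFinset.1 hσP)
    rw [mem_union, mem_filter, mem_filter, add_mul, add_mul, hcompl]
    rcases le_abs.1 hdev with h | h
    · exact Or.inl ⟨hσP, by linarith⟩
    · exact Or.inr ⟨hσP, by linarith⟩
  have hcard : (#{σ ∈ P | δ * n ≤ |(hitCount B X σ : ℝ) - #X / #L * n|} : ℝ) ≤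
      #{σ ∈ P | (#X / #L + δ : ℝ) * n ≤ hitCount B X σ} +
        #{σ ∈ P | (#(L \ X) / #L + δ : ℝ) * n ≤ hitCount B (L \ X) σ} := by
    exact_mod_cast (card_le_card hsub).trans (card_union_le _ _)
  linarith [card_hitCount_ge_le hB hX hδ0 hδ2,
    card_hitCount_ge_le (X := L \ X) hB sdiff_subset hδ0 hδ2]

end HitCount

section Averaging

variable {G Ω : Type*} [Group G] [MulAction G Ω]

open Classical in
/-- Give each pair `(ω, g)` with `g ∈ A ω` the weight `1 / #(A ω)`: the map `(ω, g) ↦ (g • ω, g)`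
preserves the weights, and they sum up to `1` over the pairs with a given `ω`. -/
theorem card_filter_le_of_forall_smul {A : Ω → Finset G} {E : Finset Ω}
    (hA : ∀ ω ∈ E, (A ω).Nonempty) (hE : ∀ ω ∈ E, ∀ g ∈ A ω, g • ω ∈ E ∧ A (g • ω) = A ω)
    {p : Ω → Prop} {q : ℝ} (hp : ∀ ω ∈ E, (#{g ∈ A ω | p (g • ω)} : ℝ) ≤ q * #(A ω)) :
    (#{ω ∈ E | p ω} : ℝ) ≤ q * #E := by
  have hpos : ∀ ω ∈ E, (#(A ω) : ℝ) ≠ 0 := fun ω hω => by exact_mod_cast (hA ω hω).card_pos.ne'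
  set W : Finset (Σ _ : Ω, G) := E.sigma A
  let T : (Σ _ : Ω, G) → Σ _ : Ω, G := fun x => ⟨x.2 • x.1, x.2⟩
  have hT : Function.Injective T := by
    rintro ⟨ω, g⟩ ⟨ω', g'⟩ h
    obtain ⟨h, rfl⟩ : g • ω = g' • ω' ∧ g = g' := by simpa [T] using h
    rw [smul_left_cancel g h]
  have hTW : ∀ x ∈ W, T x ∈ W := fun x hx => by
    obtain ⟨hx1, hx2⟩ := mem_sigma.1 hx
    obtain ⟨hE1, hE2⟩ := hE _ hx1 _ hx2
    exact mem_sigma.2 ⟨hE1, hE2 ▸ hx2⟩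
  calc (#{ω ∈ E | p ω} : ℝ)
      = ∑ x ∈ W, if p x.1 then (#(A x.1) : ℝ)⁻¹ else 0 := by
        rw [sum_sigma, card_filter, Nat.cast_sum]
        refine sum_congr rfl fun ω hω => ?_
        dsimp only
        split_ifs <;> simp [hpos ω hω]
    _ = ∑ x ∈ W, if p (T x).1 then (#(A (T x).1) : ℝ)⁻¹ else 0 :=
        (sum_nbij T hTW hT.injOn
          (surjOn_of_injOn_of_card_le T hTW hT.injOn le_rfl) fun _ _ => rfl).symm
    _ = ∑ ω ∈ E, #{g ∈ A ω | p (g • ω)} * (#(A ω) : ℝ)⁻¹ := by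
        rw [sum_sigma]
        refine sum_congr rfl fun ω hω => ?_
        rw [← nsmul_eq_mul, ← sum_const, sum_filter]
        exact sum_congr rfl fun g hg => by simp only [T, (hE ω hω g hg).2]
    _ ≤ ∑ _ ∈ E, q := sum_le_sum fun ω hω => by
        rw [← div_eq_mul_inv, div_le_iff₀ (Nat.cast_pos.2 (hA ω hω).card_pos)]
        exact hp ω hω
    _ = q * #E := by rw [sum_const, nsmul_eq_mul, mul_comm]

end Averaging

section UniformOfFinset

variable {α β γ : Type*} {A : Finset α} {W : Finset β}

theorem map_uniformOfFinset_of_bijOn (hA : A.Nonempty) (hW : W.Nonempty) {f : α → β}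
    (hf : Set.BijOn f A W) :
    (PMF.uniformOfFinset A hA).map f = PMF.uniformOfFinset W hW := by
  classical
  ext b
  rw [PMF.map_apply]
  by_cases hb : b ∈ W
  · obtain ⟨a, ha, rfl⟩ := hf.surjOn hb
    rw [tsum_eq_single a, if_pos rfl, PMF.uniformOfFinset_apply_of_mem _ ha,
      PMF.uniformOfFinset_apply_of_mem _ hb, card_nbij f hf.mapsTo hf.injOn hf.surjOn]
    exact fun a' hne => ite_eq_right_iff.2 fun h =>
      PMF.uniformOfFinset_apply_of_notMem _ fun ha' => hne (hf.injOn ha' ha h.symm)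
  · rw [PMF.uniformOfFinset_apply_of_notMem _ hb, ENNReal.tsum_eq_zero]
    exact fun a => ite_eq_right_iff.2 fun h =>
      PMF.uniformOfFinset_apply_of_notMem _ fun ha => hb (h ▸ hf.mapsTo ha)

theorem bind_uniformOfFinset_prodMk (hA : A.Nonempty) (hW : W.Nonempty) :
    ((PMF.uniformOfFinset A hA).bind fun a => (PMF.uniformOfFinset W hW).map (Prod.mk a)) =
      PMF.uniformOfFinset (A ×ˢ W) (hA.product hW) := by
  ext ⟨a, w⟩
  rw [PMF.bind_apply, tsum_eq_single a, PMF.map_apply, tsum_eq_single w, if_pos rfl]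
  · by_cases ha : a ∈ A <;> by_cases hw : w ∈ W <;>
      simp [PMF.uniformOfFinset_apply, ha, hw, ENNReal.mul_inv]
  · exact fun w' hne => if_neg fun h => hne (Prod.mk.inj h).2.symm
  · intro a' hne
    rw [PMF.map_apply, ENNReal.tsum_eq_zero.2, mul_zero]
    exact fun w' => if_neg fun h => hne (Prod.mk.inj h).1.symm

theorem bind_map_uniformOfFinset (hA : A.Nonempty) (hW : W.Nonempty) (g : α → β → γ) :
    ((PMF.uniformOfFinset A hA).bind fun a => (PMF.uniformOfFinset W hW).map (g a)) =
      (PMF.uniformOfFinset (A ×ˢ W) (hA.product hW)).map fun x => g x.1 x.2 := by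
  rw [← bind_uniformOfFinset_prodMk hA hW, PMF.map_bind]
  simp only [PMF.map_comp, Function.comp_def]

theorem map_fst_uniformOfFinset (hA : A.Nonempty) (hW : W.Nonempty) :
    (PMF.uniformOfFinset (A ×ˢ W) (hA.product hW)).map Prod.fst = PMF.uniformOfFinset A hA := by
  rw [← bind_map_uniformOfFinset hA hW fun a _ => a]
  exact (congrArg _ (funext fun a => PMF.map_const _ a)).trans (PMF.bind_pure _)

variable [MeasurableSpace α] {S T : Set α}

theorem toMeasure_uniformOfFinset_pos_iff (hA : A.Nonempty) (hS : MeasurableSet S) :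
    0 < (PMF.uniformOfFinset A hA).toMeasure S ↔ ∃ a ∈ A, a ∈ S := by
  rw [pos_iff_ne_zero, Ne, PMF.toMeasure_apply_eq_zero_iff _ hS, PMF.support_uniformOfFinset,
    Set.not_disjoint_iff]
  rfl

open Classical in
theorem one_sub_le_cond_uniformOfFinset (hA : A.Nonempty) (hS : MeasurableSet S)
    (hT : MeasurableSet T) (hne : ∃ a ∈ A, a ∈ S) {q : ℝ}
    (hq : (#{a ∈ A | a ∈ S ∧ a ∉ T} : ℝ) ≤ q * #{a ∈ A | a ∈ S}) :
    1 - q ≤ (ProbabilityTheory.cond (PMF.uniformOfFinset A hA).toMeasure S).real T := by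
  have hpos : (0 : ℝ) < #{a ∈ A | a ∈ S} := by
    exact_mod_cast card_pos.2 (hne.imp fun a ha => mem_filter.2 ha)
  have hsplit : (#{a ∈ A | a ∈ S ∧ a ∈ T} : ℝ) + #{a ∈ A | a ∈ S ∧ a ∉ T} =
      #{a ∈ A | a ∈ S} := by
    rw [← filter_filter, ← filter_filter]
    exact_mod_cast card_filter_add_card_filter_not (s := {a ∈ A | a ∈ S}) fun a => a ∈ T
  have hcond : (ProbabilityTheory.cond (PMF.uniformOfFinset A hA).toMeasure S).real T =
      (#{a ∈ A | a ∈ S ∧ a ∈ T} : ℝ) / #{a ∈ A | a ∈ S} := by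
    rw [MeasureTheory.measureReal_def, ProbabilityTheory.cond_apply hS,
      PMF.toMeasure_uniformOfFinset_apply _ _ hS,
      PMF.toMeasure_uniformOfFinset_apply _ _ (hS.inter hT)]
    simp only [ENNReal.toReal_mul, ENNReal.toReal_inv, ENNReal.toReal_div,
      ENNReal.toReal_natCast, Set.mem_inter_iff]
    rw [inv_div, mul_comm, div_mul_div_cancel₀ (Nat.cast_ne_zero.2 hA.card_ne_zero)]
  rw [hcond, le_div_iff₀ hpos]
  linarith

end UniformOfFinset

section JoinLeave

variable {c : Perm ℕ} {V : Finset ℕ} {v w : ℕ}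

theorem joinLayer_mem_permsOfFinset (hc : c ∈ permsOfFinset V) (hw : w ∈ insert v V) :
    joinLayer c v w ∈ permsOfFinset (insert v V) :=
  mul_mem_permsOfFinset (permsOfFinset_mono (subset_insert v V) hc)
    (swap_mem_permsOfFinset hw (mem_insert_self v V))

theorem leaveLayer_mem_permsOfFinset (hc : c ∈ permsOfFinset (insert v V)) :
    leaveLayer c v ∈ permsOfFinset V := by
  refine mem_permsOfFinset.2 fun x hx => ?_
  rcases eq_or_ne x v with rfl | hxv
  · exact leaveLayer_apply_self
  · have hcx : c x = x := mem_permsOfFinset.1 hc x (by simp [hxv, hx])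
    rw [leaveLayer, Perm.mul_apply, hcx,
      swap_apply_of_ne_of_ne hxv fun h => hxv (c.injective (hcx.trans h))]

theorem leaveLayer_joinLayer (hc : c v = v) : leaveLayer (joinLayer c v w) v = c := by
  rw [leaveLayer, joinLayer_apply_new, joinLayer, ← mul_assoc]
  nth_rw 1 [← hc]
  rw [← mul_swap_eq_swap_mul, mul_assoc, swap_comm w v, swap_mul_self, mul_one]

theorem joinLayer_symm_apply_new (hc : c v = v) : (joinLayer c v w).symm v = w := by
  rw [symm_apply_eq, joinLayer_apply_old hc]

theorem joinLayer_leaveLayer : joinLayer (leaveLayer c v) v (c.symm v) = c := by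
  rw [joinLayer, leaveLayer, mul_assoc, mul_swap_eq_swap_mul, apply_symm_apply, ← mul_assoc,
    swap_mul_self, one_mul]

end JoinLeave

section Stationarity

variable {V : Finset ℕ} {v : ℕ} {μ : PMF Layers} {c : Layers} {ω : Outcome}

/-- All pairs of layers on the set `V` of peers. -/
def layersOn (V : Finset ℕ) : Finset Layers := Fintype.piFinset fun _ => permsOfFinset V

theorem mem_layersOn : c ∈ layersOn V ↔ ∀ m, c m ∈ permsOfFinset V := Fintype.mem_piFinset

theorem layersOn_nonempty (V : Finset ℕ) : (layersOn V).Nonempty :=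
  ⟨1, mem_layersOn.2 fun _ => one_mem_permsOfFinset⟩

theorem layersOn_singleton (v : ℕ) : layersOn {v} = {1} := by
  refine (eq_of_subset_of_card_le ?_ ?_).symm
  · exact singleton_subset_iff.2 (mem_layersOn.2 fun _ => one_mem_permsOfFinset)
  · simp [layersOn, card_perms_of_finset]

/-- The layers after the arrival of `v`, which breaks into the outgoing edges of `x.2 0` and
`x.2 1`. -/
def joinLayers (v : ℕ) (x : Layers × (Fin 2 → ℕ)) : Layers := fun m => joinLayer (x.1 m) v (x.2 m)

/-- The layers after the departure of `v`, together with the former parents of `v`. The parents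
are kept so that the departure can be undone by `joinLayers`. -/
def leaveLayers (v : ℕ) (c : Layers) : Layers × (Fin 2 → ℕ) :=
  (fun m => leaveLayer (c m) v, fun m => (c m).symm v)

/-- The pairs of layers on `V` together with the possible choices of the new peer `v`. -/
def joinChoices (V : Finset ℕ) (v : ℕ) : Finset (Layers × (Fin 2 → ℕ)) :=
  layersOn V ×ˢ Fintype.piFinset fun _ => insert v V

theorem joinChoices_nonempty (V : Finset ℕ) (v : ℕ) : (joinChoices V v).Nonempty :=
  (layersOn_nonempty V).product (Fintype.piFinset_nonempty.2 fun _ => insert_nonempty v V)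

theorem invOn_leaveLayers_joinLayers (hv : v ∉ V) :
    Set.InvOn (leaveLayers v) (joinLayers v)
      (joinChoices V v) (layersOn (insert v V)) := by
  refine ⟨fun x hx => ?_, fun c _ => funext fun m => joinLayer_leaveLayer⟩
  have hfix m : x.1 m v = v :=
    mem_permsOfFinset.1 (mem_layersOn.1 (mem_product.1 hx).1 m) v hv
  simp only [leaveLayers, joinLayers, leaveLayer_joinLayer (hfix _),
    joinLayer_symm_apply_new (hfix _)]

theorem mapsTo_joinLayers :
    Set.MapsTo (joinLayers v) (joinChoices V v) (layersOn (insert v V)) := fun _ hx =>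
  mem_layersOn.2 fun m => joinLayer_mem_permsOfFinset (mem_layersOn.1 (mem_product.1 hx).1 m)
    (Fintype.mem_piFinset.1 (mem_product.1 hx).2 m)

theorem mapsTo_leaveLayers :
    Set.MapsTo (leaveLayers v) (layersOn (insert v V)) (joinChoices V v) := by
  intro c hc
  rw [mem_coe, mem_layersOn] at hc
  refine mem_product.2 ⟨mem_layersOn.2 fun m => leaveLayer_mem_permsOfFinset (hc m),
    Fintype.mem_piFinset.2 fun m => ?_⟩
  exact (apply_mem_iff_of_mem_permsOfFinset (inv_mem_permsOfFinset (hc m))).2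
    (mem_insert_self v V)

theorem map_joinLayers_uniformOfFinset (hv : v ∉ V) :
    (PMF.uniformOfFinset _ (joinChoices_nonempty V v)).map (joinLayers v) =
      PMF.uniformOfFinset _ (layersOn_nonempty (insert v V)) :=
  map_uniformOfFinset_of_bijOn _ _
    ((invOn_leaveLayers_joinLayers hv).bijOn mapsTo_joinLayers mapsTo_leaveLayers)

theorem map_leaveLayers_uniformOfFinset (hv : v ∉ V) :
    (PMF.uniformOfFinset _ (layersOn_nonempty (insert v V))).map (leaveLayers v) =
      PMF.uniformOfFinset _ (joinChoices_nonempty V v) :=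
  map_uniformOfFinset_of_bijOn _ _
    ((invOn_leaveLayers_joinLayers hv).symm.bijOn mapsTo_leaveLayers mapsTo_joinLayers)

theorem map_leaveLayer_uniformOfFinset (hv : v ∉ V) :
    ((PMF.uniformOfFinset _ (layersOn_nonempty (insert v V))).map
      fun c m => leaveLayer (c m) v) = PMF.uniformOfFinset _ (layersOn_nonempty V) := by
  calc _ = ((PMF.uniformOfFinset _ (layersOn_nonempty (insert v V))).map (leaveLayers v)).map
        Prod.fst := (PMF.map_comp _ _ _).symm
    _ = (PMF.uniformOfFinset _ (joinChoices_nonempty V v)).map Prod.fst := by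
        rw [map_leaveLayers_uniformOfFinset hv]
    _ = _ := map_fst_uniformOfFinset _
        (Fintype.piFinset_nonempty.2 fun _ => insert_nonempty v V)

theorem PairingLaw.source_mem (h : PairingLaw V μ) : source ∈ V := by
  induction h with
  | init => exact mem_singleton_self _
  | join v _ _ ih => exact mem_insert_of_mem ih
  | leave v _ hs _ ih => exact mem_erase.2 ⟨hs.symm, ih⟩

theorem PairingLaw.eq_uniformOfFinset (h : PairingLaw V μ) :
    μ = PMF.uniformOfFinset (layersOn V) (layersOn_nonempty V) := by
  induction h with
  | init =>
    ext c
    by_cases hc : c = 1 <;>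
      simp [PMF.pure_apply, PMF.uniformOfFinset_apply, layersOn_singleton, hc]
  | join v hv _ ih =>
    rw [ih, bind_map_uniformOfFinset _ _ fun (c : Layers) (w : Fin 2 → ℕ) m =>
      joinLayer (c m) v (w m)]
    exact map_joinLayers_uniformOfFinset hv
  | @leave V _ v hv _ _ ih =>
    rw [ih]
    simpa only [insert_erase hv] using map_leaveLayer_uniformOfFinset (notMem_erase v V)

/-- The equally likely outcomes. -/
def outcomesOn (V : Finset ℕ) : Finset Outcome :=
  (layersOn V ×ˢ V.powerset).map
    ⟨fun x => ⟨x.1, x.2⟩, fun _ _ h => Prod.ext (Outcome.mk.inj h).1 (Outcome.mk.inj h).2⟩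

theorem mem_outcomesOn : ω ∈ outcomesOn V ↔ ω.layers ∈ layersOn V ∧ ω.coins ⊆ V := by
  simp only [outcomesOn, mem_map, mem_product, mem_powerset]
  exact ⟨by rintro ⟨x, hx, rfl⟩; exact hx, fun h => ⟨(ω.layers, ω.coins), h, rfl⟩⟩

theorem outcomesOn_nonempty (V : Finset ℕ) : (outcomesOn V).Nonempty :=
  ((layersOn_nonempty V).product (powerset_nonempty V)).map

theorem PairingLaw.outcomeLaw_eq (h : PairingLaw V μ) :
    outcomeLaw V μ = PMF.uniformOfFinset (outcomesOn V) (outcomesOn_nonempty V) := by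
  have hcoins := powerset_nonempty V
  rw [outcomeLaw, h.eq_uniformOfFinset]
  refine (bind_map_uniformOfFinset _ hcoins Outcome.mk).trans
    (map_uniformOfFinset_of_bijOn _ _ ?_)
  rw [outcomesOn, coe_map]
  exact (Function.Embedding.injective _).injOn.bijOn_image

end Stationarity

section FlowAssignment

variable {ω : Outcome} {D d v : ℕ}

/-- The layer `m*` in which the peer `v` ends up having its parent of smallest depth. -/
noncomputable def mainLayer (ω : Outcome) (D v : ℕ) : Fin 2 := bestParent ω (rfa ω D) v

/-- The parent `p_{m*}(v)`, from which `v` takes over its depth and its main flow. -/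
noncomputable def mainParent (ω : Outcome) (D v : ℕ) : ℕ := parent ω (mainLayer ω D v) v

theorem depth_mainParent_le (ω : Outcome) (D v : ℕ) (m : Fin 2) :
    (rfa ω D (mainParent ω D v)).depth ≤ (rfa ω D (parent ω m v)).depth :=
  bestParent_min ω (rfa ω D) v m

theorem rfa_source (ω : Outcome) (D : ℕ) : rfa ω D source = ⟨0, 0⟩ := by
  rw [← rfa_stable]
  simp [rfaStep]

theorem rfa_of_parent_eq_source (hv : v ≠ source) (h : ∃ m, parent ω m v = source) :
    rfa ω D v = ⟨1, (mainLayer ω D v : ℕ) + 1⟩ := by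
  rw [← rfa_stable]
  simp only [rfaStep, if_neg hv, if_pos h, mainLayer]

theorem rfa_of_forall_parent_ne_source (hv : v ≠ source) (h : ∀ m, parent ω m v ≠ source)
    (hd : ∃ m, (rfa ω D (parent ω m v)).depth < D) :
    rfa ω D v =
      ⟨(rfa ω D (mainParent ω D v)).depth + 1, (rfa ω D (mainParent ω D v)).flow⟩ := by
  conv_lhs => rw [← rfa_stable]
  simp only [rfaStep, if_neg hv, not_exists.2 h, if_pos hd, if_false, mainParent, mainLayer]

theorem depth_eq_top (hD : 1 ≤ D) (hv : v ≠ source)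
    (hd : ¬ ∃ m, (rfa ω D (parent ω m v)).depth < D) : (rfa ω D v).depth = ⊤ := by
  have h : ¬ ∃ m, parent ω m v = source := fun ⟨m, hm⟩ =>
    hd ⟨m, by rw [hm, rfa_source]; exact Nat.cast_pos.2 hD⟩
  rw [← rfa_stable]
  simp only [rfaStep, if_neg hv, if_neg h, if_neg hd]

theorem depth_eq_succ (hv : v ≠ source) (hd : ∃ m, (rfa ω D (parent ω m v)).depth < D) :
    (rfa ω D v).depth = (rfa ω D (mainParent ω D v)).depth + 1 := by
  by_cases h : ∃ m, parent ω m v = source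
  · obtain ⟨m, hm⟩ := h
    have h0 := depth_mainParent_le ω D v m
    rw [hm, rfa_source, nonpos_iff_eq_zero] at h0
    rw [rfa_of_parent_eq_source hv ⟨m, hm⟩, h0, zero_add]
  · rw [rfa_of_forall_parent_ne_source hv (not_exists.1 h) hd]

theorem depth_lt_succ_iff (hD : 1 ≤ D) :
    (rfa ω D v).depth < (d + 1 : ℕ) ↔
      v = source ∨ ∃ m, (rfa ω D (parent ω m v)).depth < (min d D : ℕ) := by
  have hmin {a : ℕ∞} : a < (min d D : ℕ) ↔ a < d ∧ a < D := by
    rw [(Nat.mono_cast (α := ℕ∞)).map_min, lt_min_iff]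
  have hsucc {a : ℕ∞} : a + 1 < (d + 1 : ℕ) ↔ a < d := by
    rw [Nat.cast_add, Nat.cast_one, ENat.add_lt_add_iff_right ENat.one_ne_top]
  by_cases hv : v = source
  · simp [hv, rfa_source]
  rw [or_iff_right hv]
  constructor
  · intro h
    by_cases hd : ∃ m, (rfa ω D (parent ω m v)).depth < D
    · rw [depth_eq_succ hv hd, hsucc] at h
      obtain ⟨m, hm⟩ := hd
      exact ⟨_, hmin.2 ⟨h, (depth_mainParent_le ω D v m).trans_lt hm⟩⟩
    · rw [depth_eq_top hD hv hd] at h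
      exact absurd h not_top_lt
  · rintro ⟨m, hm⟩
    rw [depth_eq_succ hv ⟨m, (hmin.1 hm).2⟩, hsucc]
    exact (depth_mainParent_le ω D v m).trans_lt (hmin.1 hm).1

theorem depth_eq_zero_iff (hD : 1 ≤ D) : (rfa ω D v).depth = 0 ↔ v = source := by
  rw [← Order.lt_one_iff]
  simpa using depth_lt_succ_iff (ω := ω) (v := v) (d := 0) hD

theorem ne_source_of_depth_eq_succ (h : (rfa ω D v).depth = (d + 1 : ℕ)) : v ≠ source := by
  rintro rfl
  rw [rfa_source] at h
  exact d.succ_ne_zero (Nat.cast_eq_zero.1 h.symm)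

theorem exists_depth_parent_lt (hD : 1 ≤ D) (h : (rfa ω D v).depth = (d + 1 : ℕ)) :
    ∃ m, (rfa ω D (parent ω m v)).depth < D := by
  by_contra hd
  rw [depth_eq_top hD (ne_source_of_depth_eq_succ h) hd] at h
  exact ENat.natCast_ne_top _ h.symm

theorem depth_mainParent (hD : 1 ≤ D) (h : (rfa ω D v).depth = (d + 1 : ℕ)) :
    (rfa ω D (mainParent ω D v)).depth = d := by
  rw [depth_eq_succ (ne_source_of_depth_eq_succ h) (exists_depth_parent_lt hD h), Nat.cast_add,
    Nat.cast_one] at h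
  exact ENat.add_left_injective_of_ne_top ENat.one_ne_top h

theorem flow_of_depth_eq_one (hD : 1 ≤ D) (h : (rfa ω D v).depth = 1) :
    (rfa ω D v).flow = (mainLayer ω D v : ℕ) + 1 := by
  have h' : (rfa ω D v).depth = (0 + 1 : ℕ) := by simpa using h
  have hp := depth_mainParent hD h'
  rw [Nat.cast_zero, depth_eq_zero_iff hD] at hp
  rw [rfa_of_parent_eq_source (ne_source_of_depth_eq_succ h') ⟨_, hp⟩]

theorem flow_eq_flow_mainParent (hD : 1 ≤ D) (hd : 1 ≤ d)
    (h : (rfa ω D v).depth = (d + 1 : ℕ)) :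
    (rfa ω D v).flow = (rfa ω D (mainParent ω D v)).flow := by
  have hv := ne_source_of_depth_eq_succ h
  have hp : ∀ m, parent ω m v ≠ source := by
    intro m hm
    rw [rfa_of_parent_eq_source hv ⟨m, hm⟩] at h
    have := Nat.cast_eq_one.1 h.symm
    omega
  rw [rfa_of_forall_parent_ne_source hv hp (exists_depth_parent_lt hD h)]

end FlowAssignment

section Rewiring

/-- `σ • ω` is the outcome in which `σ m` is applied to all the parents in layer `m`. -/
instance : MulAction Layers Outcome where
  smul σ ω := ⟨ω.layers * σ⁻¹, ω.coins⟩
  one_smul ω := by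
    change (⟨ω.layers * 1⁻¹, ω.coins⟩ : Outcome) = ω
    rw [inv_one, mul_one]
  mul_smul σ τ ω := by
    change (⟨ω.layers * (σ * τ)⁻¹, ω.coins⟩ : Outcome) = ⟨ω.layers * τ⁻¹ * σ⁻¹, ω.coins⟩
    rw [mul_inv_rev, mul_assoc]

variable {V : Finset ℕ} {ω : Outcome} {D d v : ℕ} {σ : Layers}

theorem parent_smul (σ : Layers) (ω : Outcome) (m : Fin 2) (v : ℕ) :
    parent (σ • ω) m v = σ m (parent ω m v) := by
  change (ω.layers m * (σ m)⁻¹).symm v = σ m ((ω.layers m).symm v)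
  rw [Equiv.symm_apply_eq]
  simp

theorem smul_mem_outcomesOn (hσ : σ ∈ layersOn V) (hω : ω ∈ outcomesOn V) :
    σ • ω ∈ outcomesOn V := by
  rw [mem_outcomesOn, mem_layersOn] at *
  exact ⟨fun m => mul_mem_permsOfFinset (hω.1 m) (inv_mem_permsOfFinset (hσ m)), hω.2⟩

/-- The peers in depth `d`. -/
noncomputable def level (V : Finset ℕ) (D : ℕ) (ω : Outcome) (d : ℕ) : Finset ℕ :=
  {v ∈ V | (rfa ω D v).depth = d}

theorem mem_level : v ∈ level V D ω d ↔ v ∈ V ∧ (rfa ω D v).depth = d := mem_filter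

theorem level_subset : level V D ω d ⊆ V := filter_subset _ _

theorem layersOn_mono {S L : Finset ℕ} (h : S ⊆ L) : layersOn S ⊆ layersOn L :=
  Fintype.piFinset_subset _ _ fun _ => permsOfFinset_mono h

theorem apply_of_depth_ne (hσ : σ ∈ layersOn (level V D ω d)) (hv : (rfa ω D v).depth ≠ d)
    (m : Fin 2) : σ m v = v :=
  mem_permsOfFinset.1 (mem_layersOn.1 hσ m) v fun h => hv (mem_level.1 h).2

theorem depth_apply (hσ : σ ∈ layersOn (level V D ω d)) (m : Fin 2) (v : ℕ) :
    (rfa ω D (σ m v)).depth = (rfa ω D v).depth := by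
  have hm := mem_layersOn.1 hσ m
  by_cases hv : v ∈ level V D ω d
  · rw [(mem_level.1 hv).2, (mem_level.1 ((apply_mem_iff_of_mem_permsOfFinset hm).2 hv)).2]
  · rw [mem_permsOfFinset.1 hm v hv]

theorem depth_smul (hD : 1 ≤ D) (hσ : σ ∈ layersOn (level V D ω d)) (v : ℕ) :
    (rfa (σ • ω) D v).depth = (rfa ω D v).depth := by
  have hlt (n : ℕ) : ∀ v, (rfa (σ • ω) D v).depth < n ↔ (rfa ω D v).depth < n := by
    induction n using Nat.strong_induction_on with
    | _ n ih =>
      intro v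
      cases n with
      | zero => simp
      | succ n =>
        simp only [depth_lt_succ_iff hD, parent_smul, ih (min n D) (by omega), depth_apply hσ]
  exact ENat.eq_of_forall_natCast_le_iff fun n => by simpa only [not_lt] using (hlt n v).not

theorem level_smul (hD : 1 ≤ D) (hσ : σ ∈ layersOn (level V D ω d)) :
    level V D (σ • ω) = level V D ω := by
  funext j
  simp only [level, depth_smul hD hσ]

theorem mainLayer_smul (hD : 1 ≤ D) (hσ : σ ∈ layersOn (level V D ω d)) (v : ℕ) :
    mainLayer (σ • ω) D v = mainLayer ω D v := by
  simp only [mainLayer, bestParent, depth_smul hD hσ, parent_smul, depth_apply hσ]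
  rfl

theorem mainParent_smul (hD : 1 ≤ D) (hσ : σ ∈ layersOn (level V D ω d)) (v : ℕ) :
    mainParent (σ • ω) D v = σ (mainLayer ω D v) (mainParent ω D v) := by
  rw [mainParent, mainLayer_smul hD hσ, parent_smul, mainParent]

theorem flow_smul (hD : 1 ≤ D) (hσ : σ ∈ layersOn (level V D ω d)) {j : ℕ} (hj : j ≤ d) {v : ℕ}
    (hv : (rfa ω D v).depth = j) : (rfa (σ • ω) D v).flow = (rfa ω D v).flow := by
  induction j generalizing v with
  | zero =>
    rw [Nat.cast_zero, depth_eq_zero_iff hD] at hv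
    rw [hv, rfa_source, rfa_source]
  | succ j ih =>
    have hv' := (depth_smul hD hσ v).trans hv
    rcases j.eq_zero_or_pos with rfl | hj0
    · rw [flow_of_depth_eq_one hD (by simpa using hv'),
        flow_of_depth_eq_one hD (by simpa using hv), mainLayer_smul hD hσ]
    · have hp := depth_mainParent hD hv
      have hne : (rfa ω D (mainParent ω D v)).depth ≠ d := by
        rw [hp]
        exact_mod_cast (by omega : j ≠ d)
      rw [flow_eq_flow_mainParent hD hj0 hv', flow_eq_flow_mainParent hD hj0 hv,
        mainParent_smul hD hσ, apply_of_depth_ne hσ hne, ih (by omega) hp]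

theorem flow_smul_succ (hD : 1 ≤ D) (hd : 1 ≤ d) (hσ : σ ∈ layersOn (level V D ω d))
    (hv : (rfa ω D v).depth = (d + 1 : ℕ)) :
    (rfa (σ • ω) D v).flow = (rfa ω D (σ (mainLayer ω D v) (mainParent ω D v))).flow := by
  have hp : (rfa ω D (σ (mainLayer ω D v) (mainParent ω D v))).depth = d := by
    rw [depth_apply hσ, depth_mainParent hD hv]
  rw [flow_eq_flow_mainParent hD hd ((depth_smul hD hσ v).trans hv), mainParent_smul hD hσ,
    flow_smul hD hσ le_rfl hp]

end Rewiring

section Levels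

variable {V : Finset ℕ} {ω : Outcome} {D d : ℕ} {σ : Layers}

/-- The flow-1 peers in depth `d`. -/
noncomputable def flowOneLevel (V : Finset ℕ) (D : ℕ) (ω : Outcome) (d : ℕ) : Finset ℕ :=
  {v ∈ level V D ω d | (rfa ω D v).flow = 1}

/-- The peers in depth `d + 1` whose parent of smallest depth is their parent in layer `m`. -/
noncomputable def levelVia (V : Finset ℕ) (D : ℕ) (ω : Outcome) (d : ℕ) (m : Fin 2) : Finset ℕ :=
  {v ∈ level V D ω (d + 1) | mainLayer ω D v = m}

/-- The peers in depth `d` whose child in layer `m` takes over their main flow. -/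
noncomputable def usedParents (V : Finset ℕ) (D : ℕ) (ω : Outcome) (d : ℕ) (m : Fin 2) :
    Finset ℕ :=
  (levelVia V D ω d m).map (ω.layers m).symm.toEmbedding

/-- The proportion `X_d / N_d` of the flow-1 peers in depth `d`; it is `0` if there are no peers
in depth `d`. -/
noncomputable def flowOneRatio (V : Finset ℕ) (D : ℕ) (ω : Outcome) (d : ℕ) : ℝ :=
  flowOneCount V D ω d / levelCount V D ω d

theorem card_level (V : Finset ℕ) (D : ℕ) (ω : Outcome) (d : ℕ) :
    #(level V D ω d) = levelCount V D ω d := rfl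

theorem card_flowOneLevel (V : Finset ℕ) (D : ℕ) (ω : Outcome) (d : ℕ) :
    #(flowOneLevel V D ω d) = flowOneCount V D ω d := by
  rw [flowOneLevel, level, filter_filter, flowOneCount]

theorem flowOneLevel_subset : flowOneLevel V D ω d ⊆ level V D ω d := filter_subset _ _

theorem parent_mem_iff (hω : ω ∈ outcomesOn V) {m : Fin 2} {v : ℕ} : parent ω m v ∈ V ↔ v ∈ V :=
  apply_mem_iff_of_mem_permsOfFinset
    (inv_mem_permsOfFinset (mem_layersOn.1 (mem_outcomesOn.1 hω).1 m))

theorem mainParent_mem_level (hD : 1 ≤ D) (hω : ω ∈ outcomesOn V) {v : ℕ}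
    (hv : v ∈ level V D ω (d + 1)) : mainParent ω D v ∈ level V D ω d :=
  mem_level.2 ⟨(parent_mem_iff hω).2 (mem_level.1 hv).1, depth_mainParent hD (mem_level.1 hv).2⟩

theorem usedParents_subset (hD : 1 ≤ D) (hω : ω ∈ outcomesOn V) (m : Fin 2) :
    usedParents V D ω d m ⊆ level V D ω d := by
  intro u hu
  obtain ⟨v, hv, rfl⟩ := mem_map.1 hu
  obtain ⟨hv', rfl⟩ := mem_filter.1 hv
  exact mainParent_mem_level hD hω hv'

theorem sum_card_levelVia (f : ℕ → Prop) [DecidablePred f] :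
    ∑ m, #{v ∈ levelVia V D ω d m | f v} = #{v ∈ level V D ω (d + 1) | f v} := by
  rw [card_eq_sum_card_fiberwise (f := mainLayer ω D) (t := univ) fun _ _ => mem_univ _]
  exact sum_congr rfl fun m _ => by rw [levelVia, filter_comm]

theorem sum_card_usedParents (V : Finset ℕ) (D : ℕ) (ω : Outcome) (d : ℕ) :
    ∑ m, #(usedParents V D ω d m) = levelCount V D ω (d + 1) := by
  simpa only [usedParents, card_map, filter_true, card_level] using
    sum_card_levelVia (V := V) (D := D) (ω := ω) (d := d) fun _ => True

theorem levelCount_succ_le (hD : 1 ≤ D) (hω : ω ∈ outcomesOn V) :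
    levelCount V D ω (d + 1) ≤ 2 * levelCount V D ω d := by
  rw [← sum_card_usedParents, ← card_level]
  exact (sum_le_card_nsmul _ _ _ fun m _ => card_le_card (usedParents_subset hD hω m)).trans_eq
    (by simp)

theorem level_zero (hD : 1 ≤ D) (hV : source ∈ V) : level V D ω 0 = {source} := by
  ext v
  rw [mem_level, Nat.cast_zero, depth_eq_zero_iff hD, mem_singleton]
  exact ⟨fun h => h.2, fun h => ⟨h ▸ hV, h⟩⟩

theorem levelCount_zero (hD : 1 ≤ D) (hV : source ∈ V) : levelCount V D ω 0 = 1 := by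
  rw [← card_level, level_zero hD hV, card_singleton]

theorem levelCount_le_two_pow (hD : 1 ≤ D) (hV : source ∈ V) (hω : ω ∈ outcomesOn V) (d : ℕ) :
    levelCount V D ω d ≤ 2 ^ d := by
  induction d with
  | zero => rw [levelCount_zero hD hV, pow_zero]
  | succ d ih => exact (levelCount_succ_le hD hω).trans (by rw [pow_succ']; gcongr)

theorem flowOneLevel_smul (hD : 1 ≤ D) (hσ : σ ∈ layersOn (level V D ω d)) :
    flowOneLevel V D (σ • ω) d = flowOneLevel V D ω d := by
  rw [flowOneLevel, flowOneLevel, level_smul hD hσ]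
  exact filter_congr fun v hv => by rw [flow_smul hD hσ le_rfl (mem_level.1 hv).2]

theorem levelCount_smul (hD : 1 ≤ D) (hσ : σ ∈ layersOn (level V D ω d)) :
    levelCount V D (σ • ω) = levelCount V D ω := by
  funext j
  rw [← card_level, ← card_level, level_smul hD hσ]

theorem flowOneCount_smul_succ (hD : 1 ≤ D) (hd : 1 ≤ d) (hω : ω ∈ outcomesOn V)
    (hσ : σ ∈ layersOn (level V D ω d)) :
    flowOneCount V D (σ • ω) (d + 1) =
      hitCount (usedParents V D ω d) (flowOneLevel V D ω d) σ := by
  rw [← card_flowOneLevel, flowOneLevel, level_smul hD hσ, ← sum_card_levelVia, hitCount]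
  refine sum_congr rfl fun m _ => ?_
  rw [usedParents, filter_map, card_map]
  refine congrArg card (filter_congr fun v hv => ?_)
  obtain ⟨hv', rfl⟩ := mem_filter.1 hv
  have hσu : σ (mainLayer ω D v) (mainParent ω D v) ∈ level V D ω d :=
    (apply_mem_iff_of_mem_permsOfFinset (mem_layersOn.1 hσ _)).2 (mainParent_mem_level hD hω hv')
  rw [flow_smul_succ hD hd hσ (mem_level.1 hv').2]
  exact (and_iff_right hσu).symm.trans
    (mem_filter (p := fun u => (rfa ω D u).flow = 1)).symm

theorem usedParents_eq_level (hD : 1 ≤ D) (hω : ω ∈ outcomesOn V)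
    (h : 2 * levelCount V D ω d ≤ levelCount V D ω (d + 1)) (m : Fin 2) :
    usedParents V D ω d m = level V D ω d := by
  have hle (m : Fin 2) := card_le_card (usedParents_subset (d := d) hD hω m)
  refine eq_of_subset_of_card_le (usedParents_subset hD hω m) ?_
  rw [← sum_card_usedParents, Fin.sum_univ_two, ← card_level] at h
  have h0 := hle 0
  have h1 := hle 1
  fin_cases m <;> dsimp only [Fin.zero_eta, Fin.mk_one] <;> omega

theorem flowOneCount_succ_of_two_mul_le (hD : 1 ≤ D) (hd : 1 ≤ d) (hω : ω ∈ outcomesOn V)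
    (h : 2 * levelCount V D ω d ≤ levelCount V D ω (d + 1)) :
    flowOneCount V D ω (d + 1) = 2 * flowOneCount V D ω d := by
  have h1 : (1 : Layers) ∈ layersOn (level V D ω d) :=
    mem_layersOn.2 fun _ => one_mem_permsOfFinset
  have hX : {u ∈ level V D ω d | u ∈ flowOneLevel V D ω d} = flowOneLevel V D ω d := by
    rw [filter_mem_eq_inter, inter_eq_right.2 flowOneLevel_subset]
  rw [← one_smul Layers ω, flowOneCount_smul_succ hD hd hω h1, one_smul]
  simp only [hitCount, usedParents_eq_level hD hω h, Pi.one_apply, Perm.one_apply, hX,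
    card_flowOneLevel, Fin.sum_univ_two, two_mul]

theorem flowOneCount_one (hD : 1 ≤ D) (hV : source ∈ V) (hω : ω ∈ outcomesOn V)
    (h : 2 ≤ levelCount V D ω 1) : flowOneCount V D ω 1 = 1 := by
  have hfull : 2 * levelCount V D ω 0 ≤ levelCount V D ω (0 + 1) := by
    rwa [levelCount_zero hD hV]
  have hvia : flowOneLevel V D ω 1 = levelVia V D ω 0 0 := by
    refine filter_congr fun v hv => ?_
    rw [flow_of_depth_eq_one hD (mem_level.1 hv).2]
    omega
  rw [← card_flowOneLevel, hvia, ← card_map (ω.layers 0).symm.toEmbedding]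
  change #(usedParents V D ω 0 0) = 1
  rw [usedParents_eq_level hD hω hfull, card_level, levelCount_zero hD hV]

open Classical in
theorem card_flowOneRatio_smul_deviation_le (hD : 1 ≤ D) (hd : 1 ≤ d) (hω : ω ∈ outcomesOn V)
    {δ : ℝ} (hδ0 : 0 ≤ δ) (hδ2 : δ ≤ 2) (hpos : 0 < levelCount V D ω (d + 1)) :
    (#{σ ∈ layersOn (level V D ω d) |
        δ ≤ |flowOneRatio V D (σ • ω) (d + 1) - flowOneRatio V D (σ • ω) d|} : ℝ) ≤
      2 * Real.exp (-(levelCount V D ω (d + 1) * δ ^ 2 / 4)) * #(layersOn (level V D ω d)) := by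
  have hpos' : (0 : ℝ) < levelCount V D ω (d + 1) := by exact_mod_cast hpos
  have hdev := card_hitCount_deviation_le (usedParents_subset (d := d) hD hω)
    flowOneLevel_subset hδ0 hδ2
  rw [sum_card_usedParents, card_flowOneLevel, card_level] at hdev
  refine le_trans (Nat.cast_le.2 (card_le_card fun σ hσ => ?_)) hdev
  obtain ⟨hσ, hσδ⟩ := mem_filter.1 hσ
  refine mem_filter.2 ⟨hσ, ?_⟩
  rw [flowOneRatio, flowOneRatio, ← card_flowOneLevel V D (σ • ω) d, flowOneLevel_smul hD hσ,
    card_flowOneLevel, levelCount_smul hD hσ, flowOneCount_smul_succ hD hd hω hσ,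
    div_sub' hpos'.ne', abs_div, abs_of_pos hpos', le_div_iff₀ hpos'] at hσδ
  rwa [mul_comm (_ / _) _]

open Classical in
theorem card_flowOneRatio_deviation_le (hD : 1 ≤ D) (hd : 1 ≤ d) {E : Finset Outcome}
    (hE : E ⊆ outcomesOn V) (hinv : ∀ ω ∈ E, ∀ σ ∈ layersOn (level V D ω d), σ • ω ∈ E)
    {θ δ : ℝ} (hδ0 : 0 ≤ δ) (hδ2 : δ ≤ 2) (hθ0 : 0 < θ)
    (hθ : ∀ ω ∈ E, θ ≤ levelCount V D ω (d + 1)) :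
    (#{ω ∈ E | δ ≤ |flowOneRatio V D ω (d + 1) - flowOneRatio V D ω d|} : ℝ) ≤
      2 * Real.exp (-(θ * δ ^ 2 / 4)) * #E := by
  refine card_filter_le_of_forall_smul (A := fun ω => layersOn (level V D ω d))
    (fun ω _ => layersOn_nonempty _)
    (fun ω hω σ hσ => ⟨hinv ω hω σ hσ, by rw [level_smul hD hσ]⟩) fun ω hω => ?_
  have hpos : 0 < levelCount V D ω (d + 1) := by exact_mod_cast hθ0.trans_le (hθ ω hω)
  refine (card_flowOneRatio_smul_deviation_le hD hd (hE hω) hδ0 hδ2 hpos).trans ?_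
  gcongr
  exact hθ ω hω

end Levels

section BinaryTree

theorem exists_injOn_mapsTo_eq {ι α : Type*} {I : Finset ι} {V : Finset α} {i : ι} {a : α}
    (hi : i ∈ I) (ha : a ∈ V) (h : #I ≤ #V) :
    ∃ f : ι → α, f i = a ∧ Set.MapsTo f I V ∧ Set.InjOn f I := by
  classical
  have : Nonempty α := ⟨a⟩
  obtain ⟨f, hfV, hf⟩ := I.finite_toSet.exists_injOn_of_encard_le (t := (V : Set α))
    (by simpa only [Set.encard_coe_eq_coe_finsetCard, Nat.cast_le] using h)
  have hswap := swap_mem_permsOfFinset (hfV hi) ha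
  exact ⟨swap (f i) a ∘ f, swap_apply_left _ _,
    fun j hj => (apply_mem_iff_of_mem_permsOfFinset hswap).2 (hfV hj),
    (swap (f i) a).injective.injOn.comp hf fun _ _ => Set.mem_univ _⟩

theorem exists_mem_permsOfFinset_extending {ι α : Type*} [DecidableEq α] {I : Finset ι}
    {V : Finset α} {f g : ι → α} (hfV : Set.MapsTo f I V) (hgV : Set.MapsTo g I V)
    (hf : Set.InjOn f I) (hg : Set.InjOn g I) :
    ∃ σ ∈ permsOfFinset V, ∀ i ∈ I, σ (f i) = g i := by
  obtain ⟨τ, hτ⟩ := Perm.exists_extending_pair (α := I) (β := V) (hfV.restrict f I V)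
    (hgV.restrict g I V) (hfV.restrict_inj.2 hf) (hgV.restrict_inj.2 hg)
  refine ⟨Perm.ofSubtype τ,
    mem_permsOfFinset.2 fun x hx => Perm.ofSubtype_apply_of_not_mem τ hx, fun i hi => ?_⟩
  rw [Perm.ofSubtype_apply_of_mem τ (hfV hi)]
  exact congrArg Subtype.val (hτ ⟨i, hi⟩)

variable {V : Finset ℕ} {ω : Outcome} {D d n : ℕ} {f : ℕ → ℕ}

theorem exists_layersOn_binaryTree (hfV : Set.MapsTo f (Ico 1 (2 * n)) V)
    (hf : Set.InjOn f (Ico 1 (2 * n))) :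
    ∃ c ∈ layersOn V, ∀ m, ∀ i ∈ Ico 1 n, c m (f i) = f (2 * i + m) := by
  have hparent : Set.MapsTo id (Ico 1 n : Set ℕ) (Ico 1 (2 * n)) := fun i hi => by
    simp only [mem_coe, mem_Ico, id] at *
    omega
  have hchild (m : Fin 2) : Set.MapsTo (2 * · + (m : ℕ)) (Ico 1 n : Set ℕ) (Ico 1 (2 * n)) :=
    fun i hi => by
      simp only [mem_coe, mem_Ico] at *
      omega
  have hinj (m : Fin 2) : Set.InjOn (2 * · + (m : ℕ)) (Ico 1 n : Set ℕ) := fun i _ j _ hij => by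
    simp only at hij
    omega
  choose c hcV hc using fun m => exists_mem_permsOfFinset_extending (hfV.comp hparent)
    (hfV.comp (hchild m)) (hf.comp Function.injective_id.injOn hparent)
    (hf.comp (hinj m) (hchild m))
  exact ⟨c, mem_layersOn.2 hcV, hc⟩

theorem depth_lt_iff_of_binaryTree (hD : 1 ≤ D) (hf1 : f 1 = source)
    (hc : ∀ m, ∀ i ∈ Ico 1 (2 ^ D), ω.layers m (f i) = f (2 * i + m)) (hd : d ≤ D + 1) {v : ℕ} :
    (rfa ω D v).depth < d ↔ v ∈ f '' Ico 1 (2 ^ d) := by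
  induction d generalizing v with
  | zero => simp
  | succ d ih =>
    have hpow : 2 ^ d ≤ 2 ^ D := Nat.pow_le_pow_right two_pos (by omega)
    have hparent (m : Fin 2) {i : ℕ} (hi : i ∈ Ico 1 (2 ^ d)) (v : ℕ) :
        f i = parent ω m v ↔ f (2 * i + m) = v := by
      rw [parent, Equiv.eq_symm_apply, hc m i (Ico_subset_Ico_right hpow hi)]
    rw [depth_lt_succ_iff hD, min_eq_left (by omega)]
    simp only [ih (Nat.le_of_succ_le hd), Set.mem_image, mem_coe]
    constructor
    · rintro (rfl | ⟨m, i, hi, hiv⟩)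
      · exact ⟨1, by simp, hf1⟩
      · refine ⟨2 * i + m, ?_, (hparent m hi v).1 hiv⟩
        rw [mem_Ico] at hi ⊢
        omega
    · rintro ⟨j, hj, rfl⟩
      rw [mem_Ico] at hj
      rcases hj.1.eq_or_lt' with rfl | hj1
      · exact Or.inl hf1
      · have hi : j / 2 ∈ Ico 1 (2 ^ d) := by
          rw [mem_Ico]
          omega
        refine Or.inr ⟨⟨j % 2, Nat.mod_lt _ two_pos⟩, j / 2, hi, (hparent _ hi _).2 ?_⟩
        rw [Nat.div_add_mod]

theorem level_eq_image_of_binaryTree (hD : 1 ≤ D) (hf1 : f 1 = source)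
    (hfV : Set.MapsTo f (Ico 1 (2 ^ (D + 1))) V) (hf : Set.InjOn f (Ico 1 (2 ^ (D + 1))))
    (hc : ∀ m, ∀ i ∈ Ico 1 (2 ^ D), ω.layers m (f i) = f (2 * i + m)) (hd : d ≤ D) :
    level V D ω d = (Ico (2 ^ d) (2 ^ (d + 1))).image f := by
  have hsub : Ico 1 (2 ^ (d + 1)) ⊆ Ico 1 (2 ^ (D + 1)) :=
    Ico_subset_Ico_right (Nat.pow_le_pow_right two_pos (by omega))
  have hpow : 2 ^ d < 2 ^ (d + 1) := Nat.pow_lt_pow_succ one_lt_two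
  have hpos : 1 ≤ 2 ^ d := Nat.one_le_two_pow
  have hdepth (v : ℕ) : (rfa ω D v).depth = d ↔
      (rfa ω D v).depth < (d + 1 : ℕ) ∧ ¬ (rfa ω D v).depth < d := by
    rw [not_lt, Nat.cast_add, Nat.cast_one, ENat.lt_natCast_add_one_iff, le_antisymm_iff]
  ext v
  rw [mem_level, hdepth, depth_lt_iff_of_binaryTree hD hf1 hc (by omega),
    depth_lt_iff_of_binaryTree hD hf1 hc (by omega), mem_image]
  constructor
  · rintro ⟨-, ⟨i, hi, rfl⟩, hnot⟩
    refine ⟨i, ?_, rfl⟩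
    rw [mem_coe, mem_Ico] at hi
    rw [mem_Ico]
    exact ⟨not_lt.1 fun h => hnot ⟨i, mem_coe.2 (mem_Ico.2 ⟨hi.1, h⟩), rfl⟩, hi.2⟩
  · rintro ⟨i, hi, rfl⟩
    rw [mem_Ico] at hi
    have hi' : i ∈ Ico 1 (2 ^ (d + 1)) := mem_Ico.2 ⟨hpos.trans hi.1, hi.2⟩
    refine ⟨hfV (hsub hi'), ⟨i, hi', rfl⟩, ?_⟩
    rintro ⟨j, hj, hji⟩
    rw [mem_coe, mem_Ico] at hj
    have := hf (hsub (mem_Ico.2 ⟨hj.1, hj.2.trans hpow⟩)) (hsub hi') hji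
    omega

theorem exists_levelCount_eq_two_pow (hD : 1 ≤ D) (hV : source ∈ V) (hN : 2 ^ (D + 1) ≤ #V) :
    ∃ ω ∈ outcomesOn V, ∀ d ≤ D, levelCount V D ω d = 2 ^ d := by
  have h1 : 1 ∈ Ico 1 (2 ^ (D + 1)) := by simp
  obtain ⟨f, hf1, hfV, hf⟩ := exists_injOn_mapsTo_eq h1 hV ((Nat.card_Ico _ _).trans_le (by omega))
  obtain ⟨c, hcV, hc⟩ := exists_layersOn_binaryTree (n := 2 ^ D) (by rwa [← pow_succ'])
    (by rwa [← pow_succ'])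
  refine ⟨⟨c, ∅⟩, mem_outcomesOn.2 ⟨hcV, empty_subset V⟩, fun d hd => ?_⟩
  have hsub : Ico (2 ^ d) (2 ^ (d + 1)) ⊆ Ico 1 (2 ^ (D + 1)) :=
    Ico_subset_Ico Nat.one_le_two_pow (Nat.pow_le_pow_right two_pos (by omega))
  rw [← card_level, level_eq_image_of_binaryTree hD hf1 hfV hf hc hd,
    card_image_of_injOn (hf.mono (coe_subset.2 hsub)), Nat.card_Ico, pow_succ, mul_two,
    Nat.add_sub_cancel]

end BinaryTree

open Filter

section Asymptotics

theorem eventually_log_rpow_lt (c : ℝ) : ∀ᶠ N : ℕ in atTop, Real.log N ^ c < N := by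
  filter_upwards [tendsto_natCast_atTop_atTop.eventually
      ((isLittleO_log_rpow_rpow_atTop c one_pos).bound one_half_pos),
    eventually_gt_atTop 0] with N hN hN0
  have hN0' : (0 : ℝ) < N := Nat.cast_pos.2 hN0
  rw [Real.rpow_one, Real.norm_natCast] at hN
  linarith [Real.le_norm_self (Real.log N ^ c)]

theorem tendsto_log_natCast_rpow_atTop {c : ℝ} (hc : 0 < c) :
    Tendsto (fun N : ℕ => Real.log N ^ c) atTop atTop :=
  (tendsto_rpow_atTop hc).comp (Real.tendsto_log_atTop.comp tendsto_natCast_atTop_atTop)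

theorem two_pow_ceil_logb_lt {x : ℝ} (hx : 1 ≤ x) : (2 : ℝ) ^ ⌈Real.logb 2 x⌉₊ < 2 * x := by
  rw [← Real.rpow_natCast, ← Real.lt_logb_iff_rpow_lt one_lt_two (by positivity),
    Real.logb_mul two_ne_zero (by positivity), Real.logb_self_eq_one one_lt_two, add_comm]
  exact Nat.ceil_lt_add_one (Real.logb_nonneg one_lt_two hx)

theorem eventually_one_le_dStar (c : ℝ) : ∀ᶠ N : ℕ in atTop, 1 ≤ dStar c N := by
  filter_upwards [eventually_log_rpow_lt c, eventually_gt_atTop 1] with N hlt hN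
  have hlog : 0 < Real.log N := Real.log_pos (Nat.one_lt_cast.2 hN)
  exact Nat.ceil_pos.2 (Real.logb_pos one_lt_two ((one_lt_div (Real.rpow_pos_of_pos hlog c)).2 hlt))

theorem eventually_two_pow_dStar_add_le {c : ℝ} (hc : 0 < c) (k : ℕ) :
    ∀ᶠ N : ℕ in atTop, 2 ^ (dStar c N + k) ≤ N := by
  filter_upwards [eventually_log_rpow_lt c,
    (tendsto_log_natCast_rpow_atTop hc).eventually_ge_atTop (2 * 2 ^ k)] with N hlt hge
  have hpos : 0 < Real.log N ^ c := (by positivity : (0 : ℝ) < 2 * 2 ^ k).trans_le hge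
  have hreal : (2 : ℝ) ^ (dStar c N + k) ≤ N := calc
    (2 : ℝ) ^ (dStar c N + k) ≤ 2 * (N / Real.log N ^ c) * 2 ^ k := by
        rw [pow_add, dStar]
        gcongr
        exact (two_pow_ceil_logb_lt ((one_le_div hpos).2 hlt.le)).le
    _ = N / Real.log N ^ c * (2 * 2 ^ k) := by ring
    _ ≤ N / Real.log N ^ c * Real.log N ^ c := by gcongr
    _ = N := div_mul_cancel₀ _ hpos.ne'
  exact_mod_cast hreal

theorem eventually_natCast_rpow_neg_le {a b : ℝ} (ha : 0 < a) (hb : 0 < b) :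
    ∀ᶠ N : ℕ in atTop, (N : ℝ) ^ (-a) ≤ b :=
  ((tendsto_rpow_neg_atTop ha).comp tendsto_natCast_atTop_atTop).eventually_le_const hb

theorem eventually_le_logb_natCast (K : ℝ) : ∀ᶠ N : ℕ in atTop, K ≤ Real.logb 2 N :=
  ((Real.tendsto_logb_atTop one_lt_two).comp tendsto_natCast_atTop_atTop).eventually_ge_atTop K

theorem dStar_le_logb {c : ℝ} {N : ℕ} (hN : 2 ^ dStar c N ≤ N) :
    (dStar c N : ℝ) ≤ Real.logb 2 N := by
  have hN0 : 0 < N := (Nat.two_pow_pos _).trans_le hN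
  rw [Real.le_logb_iff_rpow_le one_lt_two (Nat.cast_pos.2 hN0), Real.rpow_natCast]
  exact_mod_cast hN

theorem rpow_one_third_le_two_pow_dOne {N : ℕ} (hN : 0 < N) :
    (N : ℝ) ^ (1 / 3 : ℝ) ≤ 2 ^ dOne N := by
  rw [← Real.rpow_natCast, ← Real.logb_le_iff_le_rpow one_lt_two (by positivity),
    Real.logb_rpow_eq_mul_logb_of_pos (Nat.cast_pos.2 hN), one_div_mul_eq_div]
  exact Nat.le_ceil _

theorem exp_neg_le_inv_exp {ε L x : ℝ} (hε : 0 < ε) (hx : 0 ≤ x) (hL : ε⁻¹ ≤ L) :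
    Real.exp (-(x * (ε / L) ^ 2 / 4)) ≤ (Real.exp ((1 - ε) * x / (4 * L ^ 4)))⁻¹ := by
  have hL0 : 0 < L := (inv_pos.2 hε).trans_le hL
  have hεL : 1 ≤ ε * L := (inv_le_iff_one_le_mul₀' hε).1 hL
  rw [← Real.exp_neg, Real.exp_le_exp, neg_le_neg_iff]
  calc (1 - ε) * x / (4 * L ^ 4) ≤ (ε * L) ^ 2 * x / (4 * L ^ 4) := by
        gcongr
        exact (sub_le_self 1 hε.le).trans (one_le_pow₀ hεL)
    _ = x * (ε / L) ^ 2 / 4 := by field_simp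

end Asymptotics

section NearBinary

variable {N d : ℕ} {n n' : ℕ → ℕ} {c : ℝ}

theorem div_sub_sum_range_mem_Icc (hN : 2 ^ (d + 5) ≤ N) (hn : ∀ h ≤ d, n h ≤ 2 ^ h) :
    (n d : ℝ) / (N - ∑ h ∈ range d, (n h : ℝ)) ∈ Set.Icc (0 : ℝ) (1 / 31) := by
  have hpos : (0 : ℝ) < 2 ^ d := by positivity
  have hnd : (n d : ℝ) ≤ 2 ^ d := by exact_mod_cast hn d le_rfl
  have hN' : (2 : ℝ) ^ d * 2 ^ 5 ≤ N := by
    rw [← pow_add]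
    exact_mod_cast hN
  have hsum : ∑ h ∈ range d, (n h : ℝ) ≤ 2 ^ d := by
    refine (sum_le_sum fun h hh => ?_).trans ((geom_sum_eq (by norm_num) d).trans_le
      (by linarith : ((2 : ℝ) ^ d - 1) / (2 - 1) ≤ 2 ^ d))
    exact_mod_cast hn h (mem_range.1 hh).le
  refine ⟨div_nonneg (Nat.cast_nonneg _) (by linarith), ?_⟩
  rw [div_le_div_iff₀ (by linarith) (by norm_num)]
  linarith

theorem phi_mem_Icc (hN : 2 ^ (d + 5) ≤ N) (hN9 : (N : ℝ) ^ (-(1 / 9) : ℝ) ≤ 1 / 2)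
    (hn : ∀ h ≤ d, n h ≤ 2 ^ h) : phi N n d ∈ Set.Icc (1 / 2 : ℝ) 1 := by
  unfold phi
  split_ifs
  · norm_num
  · have := Real.rpow_nonneg N.cast_nonneg (-(1 / 9))
    exact ⟨by linarith, by linarith⟩
  obtain ⟨hr0, hr1⟩ := div_sub_sum_range_mem_Icc hN hn
  refine ⟨?_, pow_le_one₀ (by linarith) (by linarith)⟩
  calc (1 / 2 : ℝ) ≤ (1 - 1 / 31) ^ 3 := by norm_num
    _ ≤ _ := by gcongr

theorem phi_congr (h : ∀ j ≤ d, n' j = n j) : phi N n' d = phi N n d := by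
  unfold phi
  rw [h d le_rfl, sum_congr rfl fun j hj => by rw [h j (mem_range.1 hj).le]]

theorem nearBinary_iff : NearBinary c N n ↔
    ∀ d < dStar c N, 2 * phi N n d * (n d : ℝ) ≤ (n (d + 1) : ℝ) := by
  refine ⟨fun h d hd => h (d + 1) d.succ_pos hd, fun h d hd hdD => ?_⟩
  obtain ⟨d, rfl⟩ := Nat.exists_eq_add_of_le' hd
  exact h d hdD

theorem NearBinary.congr (h : NearBinary c N n) (hn : ∀ d ≤ dStar c N, n' d = n d) :
    NearBinary c N n' := by
  rw [nearBinary_iff] at *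
  intro d hd
  rw [phi_congr fun j hj => hn j (hj.trans hd.le), hn d hd.le, hn (d + 1) hd]
  exact h d hd

theorem nearBinary_of_eq_two_pow (hN : 2 ^ (dStar c N + 4) ≤ N)
    (hN9 : (N : ℝ) ^ (-(1 / 9) : ℝ) ≤ 1 / 2) (hn : ∀ d ≤ dStar c N, n d = 2 ^ d) :
    NearBinary c N n := by
  refine nearBinary_iff.2 fun d hd => ?_
  have hphi := (phi_mem_Icc
    ((Nat.pow_le_pow_right two_pos (Nat.add_le_add_right hd 4)).trans hN) hN9 fun h hh =>
      (hn h (hh.trans hd.le)).le).2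
  rw [hn d hd.le, hn (d + 1) hd, pow_succ', Nat.cast_mul, Nat.cast_ofNat, mul_assoc]
  gcongr
  exact mul_le_of_le_one_left (Nat.cast_nonneg _) hphi

theorem NearBinary.two_mul_le (h : NearBinary c N n) (hd : d < dStar c N) (hd1 : d < dOne N) :
    2 * n d ≤ n (d + 1) := by
  have := nearBinary_iff.1 h d hd
  rw [phi, if_pos hd1, mul_one] at this
  exact_mod_cast this

theorem NearBinary.two_pow_le (h : NearBinary c N n) (hn0 : n 0 = 1) (hd : d ≤ dStar c N)
    (hd1 : d ≤ dOne N) : 2 ^ d ≤ n d := by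
  induction d with
  | zero => rw [hn0, pow_zero]
  | succ d ih =>
    rw [pow_succ']
    exact (Nat.mul_le_mul_left 2 (ih (by omega) (by omega))).trans (h.two_mul_le hd hd1)

theorem NearBinary.monotoneOn (h : NearBinary c N n) (hN : 2 ^ (dStar c N + 4) ≤ N)
    (hN9 : (N : ℝ) ^ (-(1 / 9) : ℝ) ≤ 1 / 2) (hn : ∀ d, n d ≤ 2 ^ d) :
    MonotoneOn n (Set.Iic (dStar c N)) := by
  refine monotoneOn_of_le_add_one Set.ordConnected_Iic fun d _ _ hd => ?_
  have hphi := (phi_mem_Icc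
    ((Nat.pow_le_pow_right two_pos (Nat.add_le_add_right hd 4)).trans hN) hN9 fun h _ => hn h).1
  have hstep : (n d : ℝ) ≤ n (d + 1) :=
    (le_mul_of_one_le_left (Nat.cast_nonneg _) (by linarith)).trans (nearBinary_iff.1 h d hd)
  exact_mod_cast hstep

theorem NearBinary.rpow_le (h : NearBinary c N n) (hN : 2 ^ (dStar c N + 4) ≤ N)
    (hN9 : (N : ℝ) ^ (-(1 / 9) : ℝ) ≤ 1 / 2) (hn0 : n 0 = 1) (hn : ∀ d, n d ≤ 2 ^ d)
    (hd : d ≤ dStar c N) (hd1 : dOne N ≤ d) : (N : ℝ) ^ (1 / 3 : ℝ) ≤ n d := by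
  have hle : 2 ^ dOne N ≤ n d := (h.two_pow_le hn0 (hd1.trans hd) le_rfl).trans
    (h.monotoneOn hN hN9 hn (hd1.trans hd) hd hd1)
  exact (rpow_one_third_le_two_pow_dOne ((Nat.two_pow_pos _).trans_le hN)).trans
    (by exact_mod_cast hle)

end NearBinary

section Concentration

variable {V : Finset ℕ} {ω : Outcome} {d : ℕ} {c ε δ : ℝ}

theorem flowOneRatio_one {D : ℕ} (hD : 1 ≤ D) (hV : source ∈ V) (hω : ω ∈ outcomesOn V)
    (h : 2 ≤ levelCount V D ω 1) : flowOneRatio V D ω 1 = 1 / 2 := by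
  have h2 : levelCount V D ω 1 = 2 := (levelCount_le_two_pow hD hV hω 1).antisymm h
  rw [flowOneRatio, flowOneCount_one hD hV hω h, h2, Nat.cast_one, Nat.cast_ofNat]

theorem flowOneRatio_succ_of_two_mul_le {D : ℕ} (hD : 1 ≤ D) (hd : 1 ≤ d) (hω : ω ∈ outcomesOn V)
    (h : 2 * levelCount V D ω d ≤ levelCount V D ω (d + 1)) :
    flowOneRatio V D ω (d + 1) = flowOneRatio V D ω d := by
  rw [flowOneRatio, flowOneRatio, flowOneCount_succ_of_two_mul_le hD hd hω h,
    (levelCount_succ_le hD hω).antisymm h, Nat.cast_mul, Nat.cast_mul,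
    mul_div_mul_left _ _ (Nat.cast_ne_zero.2 two_ne_zero)]

theorem balanced_of_forall_abs_sub_lt (hV : source ∈ V) (hω : ω ∈ outcomesOn V)
    (hN : 2 ^ dStar c #V ≤ #V) (hd1 : 1 ≤ dOne #V) (hε : 0 < ε)
    (hn : NearBinary c #V (levelCount V (dStar c #V) ω))
    (hdev : ∀ d ∈ Ico 1 (dStar c #V),
      |flowOneRatio V (dStar c #V) ω (d + 1) - flowOneRatio V (dStar c #V) ω d| <
        ε / Real.logb 2 #V) :
    Balanced c ε V ω := by
  intro d hd hdD
  have hD : 1 ≤ dStar c #V := hd.trans hdD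
  have hone : flowOneRatio V (dStar c #V) ω 1 = 1 / 2 :=
    flowOneRatio_one hD hV hω (hn.two_pow_le (levelCount_zero hD hV) hD hd1)
  have hdL : (d : ℝ) ≤ Real.logb 2 #V := (Nat.cast_le.2 hdD).trans (dStar_le_logb hN)
  have hL0 : 0 < Real.logb 2 #V := (Nat.cast_pos.2 hd).trans_le hdL
  have htele := dist_le_Ico_sum_of_dist_le (f := flowOneRatio V (dStar c #V) ω) hd
    (d := fun _ => ε / Real.logb 2 #V) fun {k} hk hkd => by
      rw [dist_comm, Real.dist_eq]
      exact (hdev k (mem_Ico.2 ⟨hk, hkd.trans_le hdD⟩)).le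
  rw [hone, dist_comm, Real.dist_eq, sum_const, Nat.card_Ico, nsmul_eq_mul, Nat.cast_pred hd]
    at htele
  refine htele.trans_lt ?_
  calc (d - 1 : ℝ) * (ε / Real.logb 2 #V) < Real.logb 2 #V * (ε / Real.logb 2 #V) := by
        gcongr
        linarith
    _ = ε := mul_div_cancel₀ _ hL0.ne'

open Classical in
theorem card_flowOneRatio_deviation_le_of_nearBinary (hV : source ∈ V)
    (hN : 2 ^ (dStar c #V + 4) ≤ #V) (hN9 : (#V : ℝ) ^ (-(1 / 9) : ℝ) ≤ 1 / 2)
    {E : Finset Outcome} (hE : E ⊆ outcomesOn V)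
    (hinv : ∀ ω ∈ E, ∀ σ ∈ layersOn (level V (dStar c #V) ω d), σ • ω ∈ E)
    (hn : ∀ ω ∈ E, NearBinary c #V (levelCount V (dStar c #V) ω))
    (hd : d ∈ Ico 1 (dStar c #V)) (hδ0 : 0 < δ) (hδ2 : δ ≤ 2) :
    (#{ω ∈ E | δ ≤ |flowOneRatio V (dStar c #V) ω (d + 1) -
        flowOneRatio V (dStar c #V) ω d|} : ℝ) ≤
      2 * Real.exp (-((#V : ℝ) ^ (1 / 3 : ℝ) * δ ^ 2 / 4)) * #E := by
  obtain ⟨hd, hdD⟩ := mem_Ico.1 hd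
  have hD : 1 ≤ dStar c #V := hd.trans hdD.le
  rcases lt_or_ge d (dOne #V) with hd1 | hd1
  · rw [filter_false_of_mem fun ω hω => ?_, card_empty, Nat.cast_zero]
    · positivity
    rw [flowOneRatio_succ_of_two_mul_le hD hd (hE hω) ((hn ω hω).two_mul_le hdD hd1), sub_self,
      abs_zero, not_le]
    exact hδ0
  · have hV0 : 0 < #V := (Nat.two_pow_pos _).trans_le hN
    exact card_flowOneRatio_deviation_le hD hd hE hinv hδ0.le hδ2 (by positivity) fun ω hω =>
      (hn ω hω).rpow_le hN hN9 (levelCount_zero hD hV) (levelCount_le_two_pow hD hV (hE hω)) hdD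
        (hd1.trans d.le_succ)

open Classical in
theorem card_not_balanced_le (hε : 0 < ε) (hV : source ∈ V) (hD : 1 ≤ dStar c #V)
    (hN : 2 ^ (dStar c #V + 4) ≤ #V) (hN9 : (#V : ℝ) ^ (-(1 / 9) : ℝ) ≤ 1 / 2)
    (hL : ε⁻¹ ≤ Real.logb 2 #V) (hLε : ε ≤ Real.logb 2 #V) {P : (ℕ → ℕ) → Prop}
    (hP : ∀ n, P n → NearBinary c #V n) :
    (#{ω ∈ outcomesOn V | P (levelCount V (dStar c #V) ω) ∧ ¬ Balanced c ε V ω} : ℝ) ≤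
      2 * Real.logb 2 #V /
          Real.exp ((1 - ε) * (#V : ℝ) ^ (1 / 3 : ℝ) / (4 * Real.logb 2 #V ^ 4)) *
        #{ω ∈ outcomesOn V | P (levelCount V (dStar c #V) ω)} := by
  set D := dStar c #V
  set L := Real.logb 2 #V
  set E : Finset Outcome := {ω ∈ outcomesOn V | P (levelCount V D ω)} with hE
  let B (d : ℕ) : Finset Outcome :=
    {ω ∈ E | ε / L ≤ |flowOneRatio V D ω (d + 1) - flowOneRatio V D ω d|}
  have hL0 : 0 < L := hε.trans_le hLε
  have hN' : 2 ^ D ≤ #V := (Nat.pow_le_pow_right two_pos (by omega)).trans hN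
  have hEn (ω) (hω : ω ∈ E) : NearBinary c #V (levelCount V D ω) := hP _ (mem_filter.1 hω).2
  have hinv (d) : ∀ ω ∈ E, ∀ σ ∈ layersOn (level V D ω d), σ • ω ∈ E := fun ω hω σ hσ => by
    rw [hE, mem_filter, levelCount_smul hD hσ]
    exact ⟨smul_mem_outcomesOn (layersOn_mono level_subset hσ) (mem_filter.1 hω).1,
      (mem_filter.1 hω).2⟩
  have hB (d) (hd : d ∈ Ico 1 D) :
      (#(B d) : ℝ) ≤ 2 * (Real.exp ((1 - ε) * (#V : ℝ) ^ (1 / 3 : ℝ) / (4 * L ^ 4)))⁻¹ * #E :=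
    (card_flowOneRatio_deviation_le_of_nearBinary hV hN hN9 (filter_subset _ _) (hinv d) hEn hd
      (by positivity) ((div_le_one_of_le₀ hLε hL0.le).trans one_le_two)).trans
      (by gcongr; exact exp_neg_le_inv_exp hε (by positivity) hL)
  have hcover : {ω ∈ outcomesOn V | P (levelCount V D ω) ∧ ¬ Balanced c ε V ω} ⊆
      (Ico 1 D).biUnion B := fun ω hω => by
    obtain ⟨hωV, hωP, hbal⟩ := mem_filter.1 hω
    by_contra hnot
    refine hbal (balanced_of_forall_abs_sub_lt hV hωV hN' (Nat.ceil_pos.2 (by positivity)) hε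
      (hP _ hωP) fun d hd => not_le.1 fun hle => hnot ?_)
    exact mem_biUnion.2 ⟨d, hd, mem_filter.2 ⟨mem_filter.2 ⟨hωV, hωP⟩, hle⟩⟩
  calc _ ≤ ∑ d ∈ Ico 1 D, (#(B d) : ℝ) := by
        exact_mod_cast (card_le_card hcover).trans card_biUnion_le
    _ ≤ (D - 1 : ℕ) * _ := by
        simpa only [nsmul_eq_mul, Nat.card_Ico] using sum_le_card_nsmul _ _ _ hB
    _ ≤ L * _ := by
        gcongr
        exact (Nat.cast_le.2 (Nat.sub_le _ _)).trans (dStar_le_logb hN')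
    _ = _ := by ring

end Concentration

end P2P

theorem proposition4_general (c : ℝ) (hc : 0 < c) (ε : ℝ) (hε : 0 < ε) :
    ∃ N₀ : ℕ, ∀ (V : Finset ℕ) (μ : PMF P2P.Layers), P2P.PairingLaw V μ → N₀ ≤ V.card →
      (0 < (P2P.outcomeLaw V μ).toMeasure
          {ω | P2P.NearBinary c V.card (P2P.levelCount V (P2P.dStar c V.card) ω)} ∧
        P2P.lowerBound ε V.card ≤
          (ProbabilityTheory.cond (P2P.outcomeLaw V μ).toMeasure
            {ω | P2P.NearBinary c V.card (P2P.levelCount V (P2P.dStar c V.card) ω)}).real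
            {ω | P2P.Balanced c ε V ω}) ∧
      ∀ n : ℕ → ℕ, P2P.NearBinary c V.card n →
        0 < (P2P.outcomeLaw V μ).toMeasure
          {ω | ∀ d ≤ P2P.dStar c V.card, P2P.levelCount V (P2P.dStar c V.card) ω d = n d} →
        P2P.lowerBound ε V.card ≤
          (ProbabilityTheory.cond (P2P.outcomeLaw V μ).toMeasure
            {ω | ∀ d ≤ P2P.dStar c V.card,
              P2P.levelCount V (P2P.dStar c V.card) ω d = n d}).real
            {ω | P2P.Balanced c ε V ω} := by
  classical
  obtain ⟨N₀, hN₀⟩ := Filter.eventually_atTop.1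
    ((P2P.eventually_one_le_dStar c).and <| (P2P.eventually_two_pow_dStar_add_le hc 4).and <|
      (P2P.eventually_natCast_rpow_neg_le (a := 1 / 9) (by norm_num) one_half_pos).and <|
      (P2P.eventually_le_logb_natCast ε⁻¹).and (P2P.eventually_le_logb_natCast ε))
  refine ⟨N₀, fun V μ hμ hVN => ?_⟩
  obtain ⟨hD, hN, hN9, hL, hLε⟩ := hN₀ V.card hVN
  have hV := hμ.source_mem
  have hmeas (S : Set P2P.Outcome) : MeasurableSet S := trivial
  have hbound {P : (ℕ → ℕ) → Prop} (hP : ∀ n, P n → P2P.NearBinary c V.card n)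
      (hne : ∃ ω ∈ P2P.outcomesOn V, P (P2P.levelCount V (P2P.dStar c V.card) ω)) :=
    P2P.one_sub_le_cond_uniformOfFinset (P2P.outcomesOn_nonempty V) (hmeas _) (hmeas _) hne
      (P2P.card_not_balanced_le hε hV hD hN hN9 hL hLε hP)
  rw [hμ.outcomeLaw_eq]
  obtain ⟨ω, hω, hlevel⟩ := P2P.exists_levelCount_eq_two_pow hD hV
    ((Nat.pow_le_pow_right two_pos (by omega)).trans hN)
  have hnear := P2P.nearBinary_of_eq_two_pow hN hN9 hlevel
  refine ⟨⟨(P2P.toMeasure_uniformOfFinset_pos_iff (P2P.outcomesOn_nonempty V) (hmeas _)).2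
    ⟨ω, hω, hnear⟩, hbound (fun _ h => h) ⟨ω, hω, hnear⟩⟩, fun n hn hpos => ?_⟩
  exact hbound (P := fun k => ∀ d ≤ P2P.dStar c V.card, k d = n d) (fun _ h => hn.congr h)
    ((P2P.toMeasure_uniformOfFinset_pos_iff (P2P.outcomesOn_nonempty V) (hmeas _)).1 hpos)

theorem proposition4 (c : ℝ) (hc0 : 0 < c) (hc1 : c < 1) (ε : ℝ) (hε : 0 < ε) :
    ∃ N₀ : ℕ, ∀ (V : Finset ℕ) (μ : PMF P2P.Layers), P2P.PairingLaw V μ → N₀ ≤ V.card →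
      (0 < (P2P.outcomeLaw V μ).toMeasure
          {ω | P2P.NearBinary c V.card (P2P.levelCount V (P2P.dStar c V.card) ω)} ∧
        P2P.lowerBound ε V.card ≤
          (ProbabilityTheory.cond (P2P.outcomeLaw V μ).toMeasure
            {ω | P2P.NearBinary c V.card (P2P.levelCount V (P2P.dStar c V.card) ω)}).real
            {ω | P2P.Balanced c ε V ω}) ∧
      ∀ n : ℕ → ℕ, P2P.NearBinary c V.card n →
        0 < (P2P.outcomeLaw V μ).toMeasure
          {ω | ∀ d ≤ P2P.dStar c V.card, P2P.levelCount V (P2P.dStar c V.card) ω d = n d} →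
        P2P.lowerBound ε V.card ≤
          (ProbabilityTheory.cond (P2P.outcomeLaw V μ).toMeasure
            {ω | ∀ d ≤ P2P.dStar c V.card,
              P2P.levelCount V (P2P.dStar c V.card) ω d = n d}).real
            {ω | P2P.Balanced c ε V ω} := by
  exact proposition4_general c hc0 ε hε
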